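/- Let $\mathcal N\subset B(H)$ be a von Neumann algebra on a complex Hilbert space $H$ with a fixed faithful normal semi-finite trace $\tau$. For $A\in\mathcal N$ and $t\ge 0$ let $\mu(t,A)=\inf\{\|Ap\|: p\in\mathcal N \text{ a projection},\ \tau(1-p)\le t\}$, let $$\mathcal M_{1,\infty}=\Big\{A\in\mathcal N:\ \sup_{t>0}\frac1{\log(1+t)}\int_0^t\mu(s,A)\,ds<\infty\Big\},$$ let $\mathcal M_{1,\infty}^+$ be the set of positive operators in $\mathcal M_{1,\infty}$, and write $B\prec\prec A$ if $\int_0^t\mu(s,B)\,ds\le\int_0^t\mu(s,A)\,ds$ for all $t\ge0$. Let $L_\infty(0,\infty)$ be the space of bounded Lebesgue measurable real functions on $(0,\infty)$, and let $\gamma:L_\infty(0,\infty)\to\mathbb R$ be a generalised limit, that is, a linear functional with $\gamma(z)\ge0$ for $z\ge0$, $\gamma(1)=1$, and $\gamma(z)=0$ whenever $\lim_{t\to\infty}z(t)=0$. For every $A\in\mathcal M_{1,\infty}^+$ the function $t\mapsto\frac1t\tau(A^{1+1/t})$ is finite on $(0,\infty)$ and agrees for all large $t$ with an element of $L_\infty(0,\infty)$;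 the number $$\zeta_\gamma(A)=\gamma\Big(\frac1t\tau(A^{1+1/t})\Big)$$ is defined as the value of $\gamma$ at any such element (for instance at the function cut off to $[1,\infty)$), and does not depend on its choice. Moreover $\mathcal M_{1,\infty}$ is a linear subspace of $\mathcal N$ that contains $\Re(A)_\pm$ and $\Im(A)_\pm$ for each of its elements $A$, where $\Re(A)=\frac12(A+A^*)$, $\Im(A)=\frac1{2i}(A-A^*)$ and $B_+$, $B_-\ge0$ are the positive and negative parts of a self-adjoint operator $B=B_+-B_-$. Put, for $A\in\mathcal M_{1,\infty}$, $$\zeta_\gamma(A)=\big(\zeta_\gamma(\Re(A)_+)-\zeta_\gamma(\Re(A)_-)\big)+i\big(\zeta_\gamma(\Im(A)_+)-\zeta_\gamma(\Im(A)_-)\big).$$ Then $\zeta_\gamma$ is a linear functional $\mathcal M_{1,\infty}\to\mathbb C$, and it is fully symmetric: $\zeta_\gamma(B)\le\zeta_\gamma(A)$ (both numbers being real) for all $A,B\in\mathcal M_{1,\infty}^+$ with $B\prec\prec A$. -/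

import Mathlib

open MeasureTheory Set Filter Topology
open scoped ENNReal ComplexStarModule ComplexOrder

noncomputable section

namespace ZetaFunctional

/-- `L_∞(0,∞)`: all bounded Lebesgue measurable real functions on the semi-axis. A real function is
Lebesgue measurable if and only if it is almost everywhere equal to a Borel function. -/
def LInfty : Submodule ℝ (Ioi (0 : ℝ) → ℝ) where
  carrier := {z | AEMeasurable z (Measure.comap Subtype.val volume) ∧ ∃ C : ℝ, ∀ t, |z t| ≤ C}
  add_mem' := by
    rintro a b ⟨ha, C, hC⟩ ⟨hb, D, hD⟩
    exact ⟨ha.add hb, C + D, fun t => (abs_add_le _ _).trans (add_le_add (hC t) (hD t))⟩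
  zero_mem' := ⟨aemeasurable_const, 0, fun t => by simp⟩
  smul_mem' := by
    rintro c a ⟨ha, C, hC⟩
    refine ⟨ha.const_smul c, |c| * C, fun t => ?_⟩
    simp only [Pi.smul_apply, smul_eq_mul, abs_mul]
    exact mul_le_mul_of_nonneg_left (hC t) (abs_nonneg c)

/-- The constant function one as an element of `L_∞(0,∞)`. -/
def LInfty.one : LInfty := ⟨fun _ => 1, aemeasurable_const, 1, fun t => by simp⟩

/-- Generalised limits: positive normalised linear functionals on `L_∞(0,∞)` that vanish on all
functions tending to zero at infinity. -/
structure IsGeneralisedLimit (γ : LInfty →ₗ[ℝ] ℝ) : Prop where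
  nonneg : ∀ z : LInfty, (∀ t, 0 ≤ z.1 t) → 0 ≤ γ z
  normalised : γ LInfty.one = 1
  vanish : ∀ z : LInfty, Tendsto z.1 atTop (𝓝 0) → γ z = 0

variable {H : Type*} [NormedAddCommGroup H] [InnerProductSpace ℂ H] [CompleteSpace H]

/-- `τ` is a faithful normal semi-finite trace on the von Neumann algebra `N`. A trace is a function
on the positive cone of `N`; the values of `τ` outside this cone play no role. -/
structure IsFaithfulNormalSemifiniteTrace (N : VonNeumannAlgebra H)
    (τ : (H →L[ℂ] H) → ℝ≥0∞) : Prop where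
  map_add : ∀ A ∈ N, ∀ B ∈ N, 0 ≤ A → 0 ≤ B → τ (A + B) = τ A + τ B
  map_smul : ∀ c : ℝ, 0 ≤ c → ∀ A ∈ N, 0 ≤ A → τ (c • A) = ENNReal.ofReal c * τ A
  tracial : ∀ A ∈ N, τ (star A * A) = τ (A * star A)
  faithful : ∀ A ∈ N, 0 ≤ A → τ A = 0 → A = 0
  normal : ∀ S : Set (H →L[ℂ] H), S ⊆ N → (∀ B ∈ S, 0 ≤ B) → S.Nonempty →
    DirectedOn (· ≤ ·) S → ∀ A ∈ N, IsLUB S A → IsLUB (τ '' S) (τ A)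
  semifinite : ∀ A ∈ N, 0 ≤ A → A ≠ 0 → ∃ B ∈ N, 0 ≤ B ∧ B ≤ A ∧ B ≠ 0 ∧ τ B < ∞

/-- The generalised singular value function
`μ(t, A) = inf {‖A p‖ : p a projection in N with τ(1 - p) ≤ t}`, for `t ≥ 0`. -/
def singularValue (N : VonNeumannAlgebra H) (τ : (H →L[ℂ] H) → ℝ≥0∞) (A : H →L[ℂ] H) (t : ℝ) : ℝ :=
  sInf {r | ∃ p ∈ N, IsStarProjection p ∧ τ (1 - p) ≤ ENNReal.ofReal t ∧ r = ‖A * p‖}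

/-- The Dixmier ideal `M_{1,∞}(N, τ)`, that is, the Marcinkiewicz operator space for
`ψ(t) = log (1 + t)`. -/
def dixmierIdeal (N : VonNeumannAlgebra H) (τ : (H →L[ℂ] H) → ℝ≥0∞) : Set (H →L[ℂ] H) :=
  {A | A ∈ N ∧ ∃ C : ℝ, ∀ t : ℝ, 0 < t →
    1 / Real.log (1 + t) * ∫ s in (0 : ℝ)..t, singularValue N τ A s ≤ C}

/-- Hardy-Littlewood majorization `B ≺≺ A`. -/
def Majorized (N : VonNeumannAlgebra H) (τ : (H →L[ℂ] H) → ℝ≥0∞) (B A : H →L[ℂ] H) : Prop :=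
  ∀ t : ℝ, 0 ≤ t →
    ∫ s in (0 : ℝ)..t, singularValue N τ B s ≤ ∫ s in (0 : ℝ)..t, singularValue N τ A s

/-- The function `t ↦ (1/t) τ(A^{1+1/t})` on `(0,∞)`, for a positive operator `A`. -/
def zetaFun (τ : (H →L[ℂ] H) → ℝ≥0∞) (A : H →L[ℂ] H) (t : Ioi (0 : ℝ)) : ℝ :=
  1 / (t : ℝ) * (τ (A ^ (1 + 1 / (t : ℝ)))).toReal

open Classical in
/-- `ζ_γ(A) = γ((1/t) τ(A^{1+1/t}))` for a positive operator `A`. The function may be unbounded as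
`t → 0` (if `‖A‖ > 1`), but `γ` only sees the behaviour as `t → ∞`, so that it is applied to the
function cut off to `[1,∞)`. -/
def zetaPos (τ : (H →L[ℂ] H) → ℝ≥0∞) (γ : LInfty →ₗ[ℝ] ℝ) (A : H →L[ℂ] H) : ℝ :=
  if h : indicator {t : Ioi (0 : ℝ) | 1 ≤ (t : ℝ)} (zetaFun τ A) ∈ LInfty then γ ⟨_, h⟩ else 0

/-- The extension of `ζ_γ` to arbitrary operators through
`A = (ℜ(A)₊ - ℜ(A)₋) + i (ℑ(A)₊ - ℑ(A)₋)`. -/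
def zeta (τ : (H →L[ℂ] H) → ℝ≥0∞) (γ : LInfty →ₗ[ℝ] ℝ) (A : H →L[ℂ] H) : ℂ :=
  ((zetaPos τ γ (ℜ A : H →L[ℂ] H)⁺ : ℂ) - (zetaPos τ γ (ℜ A : H →L[ℂ] H)⁻ : ℂ)) +
    Complex.I *
      ((zetaPos τ γ (ℑ A : H →L[ℂ] H)⁺ : ℂ) - (zetaPos τ γ (ℑ A : H →L[ℂ] H)⁻ : ℂ))

/-- A linear functional on a space `S` of operators is fully symmetric if it is monotone on positive
operators for Hardy-Littlewood majorization. The inequality between complex numbers says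
that their difference is real and non-negative. -/
def IsFullySymmetric (N : VonNeumannAlgebra H) (τ : (H →L[ℂ] H) → ℝ≥0∞)
    {S : Submodule ℂ (H →L[ℂ] H)} (φ : S →ₗ[ℂ] ℂ) : Prop :=
  ∀ A B : S, 0 ≤ (A : H →L[ℂ] H) → 0 ≤ (B : H →L[ℂ] H) →
    Majorized N τ (B : H →L[ℂ] H) (A : H →L[ℂ] H) → φ B ≤ φ A

end ZetaFunctional

end

/-!
Full symmetry rests on the trace formula `τ(A ^ p) = ∫₀^∞ μ(s, A) ^ p ds`: for `p > 1` it turns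
Hardy-Littlewood majorization into monotonicity of `A ↦ τ(A ^ p)`, because an inequality between
the primitives of two functions, the smaller of which is decreasing, passes to their `p`-th powers.
Comparing `μ(·, A)` in the same way with `s ↦ C / (1 + s)` gives `τ(A ^ p) ≤ C ^ p / (p - 1)`, hence
the boundedness of `t ↦ (1/t) τ(A^{1+1/t})` for `t ≥ 1`.

Additivity on positive operators comes from
`τ(A^{1+s}) + τ(B^{1+s}) ≤ τ((A+B)^{1+s}) ≤ 2^s (τ(A^{1+s}) + τ(B^{1+s}))` for `0 < s < 1`, a
consequence of the operator monotonicity of `x ^ s` and the operator convexity of `x ^ (1 + s)`.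
With `s = 1/t` the factor `2^s` tends to `1`, so that a generalised limit does not see it. A
functional that is additive and positively homogeneous on positive operators extends linearly
through the Jordan decomposition.
-/

namespace ZetaFunctional

section CStarAlgebra

variable {𝒜 : Type*} [CStarAlgebra 𝒜]

theorem norm_mul_le_of_isStarProjection {q : 𝒜} (hq : IsStarProjection q) (A : 𝒜) :
    ‖A * q‖ ≤ ‖A‖ :=
  (norm_mul_le A q).trans (mul_le_of_le_one_right (norm_nonneg A) hq.norm_le)

theorem norm_mul_le_of_isStarProjection_left {q : 𝒜} (hq : IsStarProjection q) (A : 𝒜) :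
    ‖q * A‖ ≤ ‖A‖ :=
  (norm_mul_le q A).trans (mul_le_of_le_one_left (norm_nonneg A) hq.norm_le)

variable [PartialOrder 𝒜] [StarOrderedRing 𝒜]

theorem le_smul_of_mul_eq {q T : 𝒜} {c : ℝ} (hq : IsStarProjection q) (hT : IsSelfAdjoint T)
    (hTc : T ≤ c • 1) (h : T * q = T) : T ≤ c • q := by
  have hqT : q * T = T := by simpa [hT.star_eq, hq.isSelfAdjoint.star_eq] using congr(star $h)
  simpa [hq.isSelfAdjoint.star_eq, hqT, h, hq.isIdempotentElem.eq]
    using star_left_conjugate_le_conjugate hTc q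

theorem smul_le_of_mul_eq {q T : 𝒜} {c : ℝ} (hq : IsStarProjection q) (hT : 0 ≤ T)
    (h : T * q = c • q) : c • q ≤ T := by
  have hqT : q * T = c • q := by
    simpa [(IsSelfAdjoint.of_nonneg hT).star_eq, hq.isSelfAdjoint.star_eq] using congr(star $h)
  have hcompr := star_left_conjugate_nonneg hT (1 - q)
  simpa [hq.one_sub.isSelfAdjoint.star_eq, sub_mul, mul_sub, h, hqT, hq.isIdempotentElem.eq]
    using hcompr

theorem norm_mul_le_norm_mul_of_le {p q : 𝒜} (hq : IsStarProjection q) (hp : IsStarProjection p)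
    (hqp : q ≤ p) (A : 𝒜) : ‖A * q‖ ≤ ‖A * p‖ := by
  rw [← (hq.le_iff_mul_eq_right hp).1 hqp, ← mul_assoc]
  exact norm_mul_le_of_isStarProjection hq (A * p)

theorem norm_mul_le_of_star_mul_self_le {A B : 𝒜} (h : star B * B ≤ star A * A) (p : 𝒜) :
    ‖B * p‖ ≤ ‖A * p‖ := by
  have hconj : star (B * p) * (B * p) ≤ star (A * p) * (A * p) := by
    simpa only [star_mul, mul_assoc] using star_left_conjugate_le_conjugate h p
  have hsq := CStarAlgebra.norm_le_norm_of_nonneg_of_le (star_mul_self_nonneg _) hconj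
  rw [CStarRing.norm_star_mul_self, CStarRing.norm_star_mul_self] at hsq
  exact (mul_self_le_mul_self_iff (norm_nonneg _) (norm_nonneg _)).2 hsq

theorem mul_eq_zero_of_nonneg_of_le {S T q : 𝒜} (hT : 0 ≤ T) (hTS : T ≤ S) (h : S * q = 0) :
    T * q = 0 := by
  have hconj : star q * T * q = 0 := le_antisymm
    (by simpa [mul_assoc, h] using star_left_conjugate_le_conjugate hTS q)
    (star_left_conjugate_nonneg hT q)
  have hsqrt : CFC.sqrt T * q = 0 := by
    rw [← norm_eq_zero, ← sq_eq_zero_iff, ← CFC.norm_star_mul_mul_self_of_nonneg q hT,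
      hconj, norm_zero]
  rw [← CFC.sqrt_mul_sqrt_self T, mul_assoc, hsqrt, mul_zero]

end CStarAlgebra

section StrongLimits

variable {𝕜 E ι : Type*} [RCLike 𝕜] [NormedAddCommGroup E] [InnerProductSpace 𝕜 E]

theorem isLUB_of_tendsto {u : ι → E →L[𝕜] E} {A : E →L[𝕜] E} {l : Filter ι} [l.NeBot]
    (hle : ∀ n, u n ≤ A) (hlim : ∀ v, Tendsto (fun n => u n v) l (𝓝 (A v))) :
    IsLUB (Set.range u) A := by
  refine ⟨forall_mem_range.2 hle, fun B hB => ?_⟩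
  have hpos : ∀ n, (B - u n).IsPositive := fun n => (ContinuousLinearMap.le_def _ _).1 (hB ⟨n, rfl⟩)
  have hlim' : ∀ v, Tendsto (fun n => (B - u n) v) l (𝓝 ((B - A) v)) := fun v =>
    tendsto_const_nhds.sub (hlim v)
  rw [ContinuousLinearMap.le_def]
  refine ⟨fun v w => ?_, fun v => ?_⟩
  · exact tendsto_nhds_unique ((hlim' v).inner tendsto_const_nhds)
      ((tendsto_const_nhds.inner (hlim' w)).congr fun n => ((hpos n).isSymmetric v w).symm)
  · exact ge_of_tendsto' ((RCLike.continuous_re.tendsto _).comp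
      ((hlim' v).inner tendsto_const_nhds)) fun n => (hpos n).2 v

variable [CompleteSpace E]

/-- The orthogonal projection onto the closure of the range of an operator. -/
noncomputable def rangeProj (X : E →L[𝕜] E) : E →L[𝕜] E :=
  X.range.topologicalClosure.starProjection

theorem isStarProjection_rangeProj (X : E →L[𝕜] E) : IsStarProjection (rangeProj X) :=
  isStarProjection_starProjection

theorem rangeProj_apply_mem (X : E →L[𝕜] E) (v : E) : rangeProj X v ∈ closure (Set.range X) :=
  Submodule.starProjection_apply_mem X.range.topologicalClosure v

theorem rangeProj_mul (X : E →L[𝕜] E) : rangeProj X * X = X := by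
  ext v
  exact Submodule.starProjection_eq_self_iff.2
    (Submodule.le_topologicalClosure _ (LinearMap.mem_range_self _ v))

theorem mul_rangeProj_eq_of_mul_eq {X Y Z : E →L[𝕜] E} (h : Y * X = Z * X) :
    Y * rangeProj X = Z * rangeProj X := by
  ext v
  exact (isClosed_eq Y.continuous Z.continuous).closure_subset_iff.2
    (forall_mem_range.2 fun u => congr($h u)) (rangeProj_apply_mem X v)

theorem commute_rangeProj {X Y : E →L[𝕜] E} (h : Commute Y X) (h' : Commute (star Y) X) :
    Commute Y (rangeProj X) := by
  have hp := (isStarProjection_rangeProj X).isSelfAdjoint.star_eq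
  have invariant : ∀ {Z : E →L[𝕜] E}, Commute Z X → rangeProj X * Z * rangeProj X =
      Z * rangeProj X := fun {Z} hZ => mul_rangeProj_eq_of_mul_eq <| by
    rw [mul_assoc, hZ.eq, ← mul_assoc, rangeProj_mul]
  have hstar := congr(star $(invariant h'))
  simp only [star_mul, star_star, hp, ← mul_assoc] at hstar
  exact (invariant h).symm.trans hstar

theorem tendsto_rangeProj {X : E →L[𝕜] E} {u : ι → E →L[𝕜] E} {l : Filter ι} {C : ℝ}
    (hbound : ∀ n, ‖u n‖ ≤ C) (hmul : ∀ n, u n * rangeProj X = u n)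
    (hlim : Tendsto (fun n => u n * X) l (𝓝 X)) (v : E) :
    Tendsto (fun n => u n v) l (𝓝 (rangeProj X v)) := by
  have hequi : Equicontinuous fun n => ⇑(u n) := 
    (LipschitzWith.uniformEquicontinuous _ C.toNNReal fun n =>
      (u n).lipschitz.weaken (NNReal.le_toNNReal_of_coe_le (hbound n))).equicontinuous
  have hrange : ∀ w ∈ Set.range X, Tendsto (fun n => u n w) l (𝓝 w) :=
    forall_mem_range.2 fun w => ((ContinuousLinearMap.apply 𝕜 E w).continuous.tendsto X).comp hlim
  refine ((hequi _).tendsto_of_mem_closure continuousWithinAt_id hrange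
    (rangeProj_apply_mem X v)).congr fun n => ?_
  exact congr($(hmul n) v)

end StrongLimits

/-- A continuous approximation of the sign function, equal to `x / (|x| + ε)`. On the positive
half-axis it takes its values in `[0, 1]` and increases to `1` as `ε` decreases to `0`. -/
noncomputable def regSign (ε x : ℝ) : ℝ := (|x| + ε)⁻¹ * x

section RegSign

variable {ε δ x : ℝ}

theorem continuous_inv_abs_add (hε : 0 < ε) : Continuous fun x : ℝ => (|x| + ε)⁻¹ :=
  Continuous.inv₀ (by fun_prop) fun x => by positivity

theorem continuous_regSign (hε : 0 < ε) : Continuous (regSign ε) :=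
  (continuous_inv_abs_add hε).mul continuous_id

theorem regSign_nonneg (hε : 0 < ε) (hx : 0 ≤ x) : 0 ≤ regSign ε x := by
  unfold regSign; positivity

theorem regSign_le_one (hε : 0 < ε) (hx : 0 ≤ x) : regSign ε x ≤ 1 := by
  rw [regSign, abs_of_nonneg hx, inv_mul_le_one₀ (by positivity)]
  linarith

theorem regSign_le_inv_mul (hε : 0 < ε) (hx : 0 ≤ x) : regSign ε x ≤ ε⁻¹ * x := by
  unfold regSign
  gcongr
  exact le_add_of_nonneg_left (abs_nonneg x)

theorem regSign_anti (hε : 0 < ε) (h : ε ≤ δ) (hx : 0 ≤ x) : regSign δ x ≤ regSign ε x := by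
  unfold regSign
  gcongr

theorem mul_sq_one_sub_regSign_le (hε : 0 < ε) (hx : 0 ≤ x) :
    (1 - regSign ε x) * x * (1 - regSign ε x) ≤ ε := by
  have hsub : 1 - regSign ε x = ε / (x + ε) := by
    rw [regSign, abs_of_nonneg hx]; field_simp; ring
  rw [hsub, show ε / (x + ε) * x * (ε / (x + ε)) = ε * (ε * x / (x + ε) ^ 2) by field_simp]
  refine mul_le_of_le_one_right hε.le ((div_le_one (by positivity)).2 ?_)
  nlinarith

end RegSign

section RangeApproximation

variable {H : Type*} [NormedAddCommGroup H] [InnerProductSpace ℂ H] [CompleteSpace H]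
  {ε : ℝ}

theorem mul_self_mul_mul_star_eq_cfc {f : ℝ → ℝ} (hf : Continuous f) (X : H →L[ℂ] H) :
    (cfc f (X * star X) * X) * star (cfc f (X * star X) * X) =
      cfc (fun x => f x * x * f x) (X * star X) := by
  rw [cfc_mul (fun x => f x * x) f _ (by fun_prop) hf.continuousOn,
    cfc_mul f (fun x => x) _ hf.continuousOn (by fun_prop),
    cfc_id' ℝ (X * star X) (.mul_star_self X), star_mul, (cfc_predicate f (X * star X)).star_eq]
  simp only [mul_assoc]

theorem cfc_regSign_nonneg (hε : 0 < ε) (X : H →L[ℂ] H) : 0 ≤ cfc (regSign ε) (X * star X) :=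
  cfc_nonneg fun _ hx => regSign_nonneg hε (spectrum_nonneg_of_nonneg (mul_star_self_nonneg X) hx)

theorem norm_cfc_regSign_le_one (hε : 0 < ε) (X : H →L[ℂ] H) :
    ‖cfc (regSign ε) (X * star X)‖ ≤ 1 :=
  norm_cfc_le zero_le_one fun x hx => by
    have hx0 : 0 ≤ x := spectrum_nonneg_of_nonneg (mul_star_self_nonneg X) hx
    rw [Real.norm_of_nonneg (regSign_nonneg hε hx0)]
    exact regSign_le_one hε hx0

theorem cfc_regSign_mul_rangeProj (hε : 0 < ε) (X : H →L[ℂ] H) :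
    cfc (regSign ε) (X * star X) * rangeProj X = cfc (regSign ε) (X * star X) := by
  have hle : cfc (regSign ε) (X * star X) ≤ ε⁻¹ • (X * star X) := by
    rw [← cfc_const_mul_id ε⁻¹ (X * star X) (.mul_star_self X)]
    exact cfc_mono (fun x hx =>
      regSign_le_inv_mul hε (spectrum_nonneg_of_nonneg (mul_star_self_nonneg X) hx))
      (continuous_regSign hε).continuousOn
  have hstar : star X * rangeProj X = star X := by
    simpa [(isStarProjection_rangeProj X).isSelfAdjoint.star_eq] using
      congr(star $(rangeProj_mul X))
  have hzero := mul_eq_zero_of_nonneg_of_le (q := 1 - rangeProj X) (cfc_regSign_nonneg hε X) hle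
    (by rw [smul_mul_assoc, mul_assoc, mul_sub, hstar, mul_one, sub_self, mul_zero, smul_zero])
  rw [mul_sub, mul_one, sub_eq_zero] at hzero
  exact hzero.symm

theorem norm_cfc_regSign_mul_sub_le (hε : 0 < ε) (X : H →L[ℂ] H) :
    ‖cfc (regSign ε) (X * star X) * X - X‖ ≤ √ε := by
  have hsub : X - cfc (regSign ε) (X * star X) * X =
      cfc (fun x => 1 - regSign ε x) (X * star X) * X := by
    rw [cfc_sub _ _ _ continuousOn_const (continuous_regSign hε).continuousOn,
      cfc_const_one ℝ (X * star X), sub_mul, one_mul]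
  rw [norm_sub_rev, hsub]
  refine Real.le_sqrt_of_sq_le ?_
  have hcont : Continuous fun x => 1 - regSign ε x :=
    continuous_const.sub (continuous_regSign hε)
  rw [sq, ← CStarRing.norm_self_mul_star, mul_self_mul_mul_star_eq_cfc hcont]
  refine norm_cfc_le hε.le fun x hx => ?_
  have hx0 : 0 ≤ x := spectrum_nonneg_of_nonneg (mul_star_self_nonneg X) hx
  have h1 := sub_nonneg.2 (regSign_le_one hε hx0)
  rw [Real.norm_of_nonneg (by positivity)]
  exact mul_sq_one_sub_regSign_le hε hx0

theorem tendsto_cfc_regSign {ι : Type*} {l : Filter ι} {ε : ι → ℝ} (hε : ∀ n, 0 < ε n)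
    (hlim : Tendsto ε l (𝓝 0)) (X : H →L[ℂ] H) (v : H) :
    Tendsto (fun n => cfc (regSign (ε n)) (X * star X) v) l (𝓝 (rangeProj X v)) := by
  refine tendsto_rangeProj (fun n => norm_cfc_regSign_le_one (hε n) X)
    (fun n => cfc_regSign_mul_rangeProj (hε n) X) ?_ v
  rw [tendsto_iff_norm_sub_tendsto_zero]
  refine squeeze_zero (fun n => norm_nonneg _) (fun n => norm_cfc_regSign_mul_sub_le (hε n) X) ?_
  simpa using hlim.sqrt

theorem cfc_regSign_eq_mul_star (hε : 0 < ε) (X : H →L[ℂ] H) :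
    cfc (regSign ε) (X * star X) = (cfc (fun x => √(|x| + ε)⁻¹) (X * star X) * X) *
      star (cfc (fun x => √(|x| + ε)⁻¹) (X * star X) * X) := by
  rw [mul_self_mul_mul_star_eq_cfc (continuous_inv_abs_add hε).sqrt]
  refine cfc_congr fun x _ => ?_
  rw [regSign, mul_right_comm, Real.mul_self_sqrt (by positivity)]

theorem cfc_regSign_le_rangeProj (hε : 0 < ε) (X : H →L[ℂ] H) :
    cfc (regSign ε) (X * star X) ≤ rangeProj X := by
  have hle : cfc (regSign ε) (X * star X) ≤ (1 : ℝ) • 1 := by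
    rw [one_smul]
    exact (CStarAlgebra.norm_le_one_iff_of_nonneg _ (cfc_regSign_nonneg hε X)).1
      (norm_cfc_regSign_le_one hε X)
  simpa only [one_smul] using le_smul_of_mul_eq (isStarProjection_rangeProj X)
    (cfc_predicate (regSign ε) (X * star X)) hle (cfc_regSign_mul_rangeProj hε X)

end RangeApproximation

section Trace

variable {H : Type*} [NormedAddCommGroup H] [InnerProductSpace ℂ H] [CompleteSpace H]
  {N : VonNeumannAlgebra H} {τ : (H →L[ℂ] H) → ℝ≥0∞} {A B X Z e p q : H →L[ℂ] H}

theorem mem_of_forall_commute (hA : A ∈ N)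
    (h : ∀ y, Commute A y → Commute A (star y) → Commute B y) : B ∈ N := by
  rw [← N.commutant_commutant, VonNeumannAlgebra.mem_commutant_iff]
  intro y hy
  have commute : ∀ z ∈ N.commutant, Commute A z := fun z hz =>
    VonNeumannAlgebra.mem_commutant_iff.1 hz A hA
  exact (h y (commute y hy) (commute _ (star_mem hy))).symm

theorem cfc_mem (hA : A ∈ N) (f : ℝ → ℝ) : cfc f A ∈ N :=
  mem_of_forall_commute hA fun _ hy _ => hy.cfc_real f

theorem rpow_mem (hA : A ∈ N) (r : ℝ) : A ^ r ∈ N :=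
  mem_of_forall_commute hA fun _ hy _ => hy.cfc_nnreal _

theorem posPart_mem (hA : A ∈ N) : A⁺ ∈ N :=
  mem_of_forall_commute hA fun _ hy _ => hy.cfcₙ_real _

theorem rangeProj_mem (hX : X ∈ N) : rangeProj X ∈ N :=
  mem_of_forall_commute hX fun _ hy hy' => (commute_rangeProj hy.symm hy'.symm).symm

theorem one_sub_mem (hp : p ∈ N) : 1 - p ∈ N :=
  sub_mem (one_mem N) hp

theorem real_smul_mem (c : ℝ) (hA : A ∈ N) : c • A ∈ N := by
  rw [← Complex.coe_smul]
  exact N.toStarSubalgebra.smul_mem hA _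

/-- A normal trace on a von Neumann algebra, neither faithful nor semi-finite in general. As in
`IsFaithfulNormalSemifiniteTrace`, the values of `τ` outside the positive cone of `N` play no
role. -/
structure IsNormalTrace (N : VonNeumannAlgebra H) (τ : (H →L[ℂ] H) → ℝ≥0∞) : Prop where
  map_add : ∀ A ∈ N, ∀ B ∈ N, 0 ≤ A → 0 ≤ B → τ (A + B) = τ A + τ B
  map_smul : ∀ c : ℝ, 0 ≤ c → ∀ A ∈ N, 0 ≤ A → τ (c • A) = ENNReal.ofReal c * τ A
  tracial : ∀ A ∈ N, τ (star A * A) = τ (A * star A)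
  normal : ∀ S : Set (H →L[ℂ] H), S ⊆ N → (∀ B ∈ S, 0 ≤ B) → S.Nonempty →
    DirectedOn (· ≤ ·) S → ∀ A ∈ N, IsLUB S A → IsLUB (τ '' S) (τ A)

theorem IsFaithfulNormalSemifiniteTrace.isNormalTrace
    (hτ : IsFaithfulNormalSemifiniteTrace N τ) : IsNormalTrace N τ :=
  ⟨hτ.map_add, hτ.map_smul, hτ.tracial, hτ.normal⟩

theorem tau_zero (hτ : IsNormalTrace N τ) : τ 0 = 0 := by
  simpa using hτ.map_smul 0 le_rfl 0 (zero_mem _) le_rfl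

theorem tau_mono (hτ : IsNormalTrace N τ) (hA : A ∈ N) (hB : B ∈ N) (hA0 : 0 ≤ A)
    (hAB : A ≤ B) : τ A ≤ τ B := by
  have hadd := hτ.map_add A hA (B - A) (sub_mem hB hA) hA0 (sub_nonneg.2 hAB)
  rw [add_sub_cancel] at hadd
  exact hadd ▸ le_self_add

theorem tau_le_of_isLUB {ι : Type*} [Preorder ι] [IsDirectedOrder ι] [Nonempty ι]
    (hτ : IsNormalTrace N τ) {u : ι → H →L[ℂ] H} (hu : Monotone u) (huN : ∀ i, u i ∈ N)
    (hu0 : ∀ i, 0 ≤ u i) (hA : A ∈ N) (hlub : IsLUB (Set.range u) A) {c : ℝ≥0∞}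
    (hc : ∀ i, τ (u i) ≤ c) : τ A ≤ c := by
  refine (hτ.normal (Set.range u) (range_subset_iff.2 huN) (forall_mem_range.2 hu0)
    (range_nonempty u) (directedOn_range.2 hu.directed_le) A hA hlub).2 ?_
  rintro _ ⟨_, ⟨i, rfl⟩, rfl⟩
  exact hc i

theorem tau_mul_star_self_le (hτ : IsNormalTrace N τ) (hZ : Z ∈ N) (hq : q ∈ N)
    (hqp : IsStarProjection q) (hZ1 : ‖Z‖ ≤ 1) (h : Z * q = Z) : τ (Z * star Z) ≤ τ q := by
  have hle : star Z * Z ≤ (1 : ℝ) • 1 := by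
    rw [one_smul, ← CStarAlgebra.norm_le_one_iff_of_nonneg _ (star_mul_self_nonneg Z),
      CStarRing.norm_star_mul_self]
    exact mul_le_one₀ hZ1 (norm_nonneg Z) hZ1
  rw [← hτ.tracial Z hZ]
  refine tau_mono hτ (mul_mem (star_mem hZ) hZ) hq (star_mul_self_nonneg Z) ?_
  simpa only [one_smul] using le_smul_of_mul_eq hqp (.star_mul_self Z) hle (by rw [mul_assoc, h])

theorem tau_cfc_regSign_le (hτ : IsNormalTrace N τ) {ε : ℝ} (hε : 0 < ε) (hX : X ∈ N) (hq : q ∈ N)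
    (hqp : IsStarProjection q) (h : X * q = X) : τ (cfc (regSign ε) (X * star X)) ≤ τ q := by
  have hnorm := norm_cfc_regSign_le_one hε X
  rw [cfc_regSign_eq_mul_star hε] at hnorm ⊢
  refine tau_mul_star_self_le hτ (mul_mem (cfc_mem (mul_mem hX (star_mem hX)) _) hX) hq hqp ?_
    (by rw [mul_assoc, h])
  rw [CStarRing.norm_self_mul_star] at hnorm
  exact (sq_le_one_iff₀ (norm_nonneg _)).1 ((sq _).trans_le hnorm)

theorem tau_rangeProj_le (hτ : IsNormalTrace N τ) (hX : X ∈ N) (hq : q ∈ N)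
    (hqp : IsStarProjection q) (h : X * q = X) : τ (rangeProj X) ≤ τ q := by
  have hε : ∀ n : ℕ, (0 : ℝ) < 1 / (n + 1) := fun n => by positivity
  refine tau_le_of_isLUB hτ (fun m n hmn => ?_) (fun n => cfc_mem (mul_mem hX (star_mem hX)) _)
    (fun n => cfc_regSign_nonneg (hε n) X) (rangeProj_mem hX)
    (isLUB_of_tendsto (fun n => cfc_regSign_le_rangeProj (hε n) X)
      (tendsto_cfc_regSign hε tendsto_one_div_add_atTop_nhds_zero_nat X))
    (fun n => tau_cfc_regSign_le hτ (hε n) hX hq hqp h)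
  exact cfc_mono (fun x hx => regSign_anti (hε n) (Nat.one_div_le_one_div hmn)
      (spectrum_nonneg_of_nonneg (mul_star_self_nonneg X) hx))
    (continuous_regSign (hε m)).continuousOn (continuous_regSign (hε n)).continuousOn

theorem tau_le_of_norm_mul_lt_one (hτ : IsNormalTrace N τ) (he : e ∈ N) (hep : IsStarProjection e)
    (hp : p ∈ N) (hpp : IsStarProjection p) (h : ‖e * p‖ < 1) : τ e ≤ τ (1 - p) := by
  set X := e * (1 - p) with hX
  have hXN : X ∈ N := mul_mem he (one_sub_mem hp)
  set Y := (1 - rangeProj X) * e with hY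
  have hYX : (1 - rangeProj X) * X = 0 := by rw [sub_mul, one_mul, rangeProj_mul, sub_self]
  have hYp : Y = Y * (e * p) := by
    rw [hX, ← mul_assoc, mul_sub, mul_one, sub_eq_zero] at hYX
    rw [hY, ← mul_assoc, mul_assoc _ e e, hep.isIdempotentElem.eq]
    exact hYX
  have hY0 : ‖Y‖ = 0 := by
    have hle : ‖Y‖ ≤ ‖Y‖ * ‖e * p‖ := (congrArg norm hYp).trans_le (norm_mul_le _ _)
    nlinarith [norm_nonneg Y]
  have hle : e ≤ rangeProj X := by
    rw [hep.le_iff_mul_eq_right (isStarProjection_rangeProj X)]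
    rw [norm_eq_zero, hY, sub_mul, one_mul, sub_eq_zero] at hY0
    exact hY0.symm
  exact (tau_mono hτ he (rangeProj_mem hXN) hep.nonneg hle).trans
    (tau_rangeProj_le hτ hXN (one_sub_mem hp) hpp.one_sub
      (by rw [hX, mul_assoc, hpp.one_sub.isIdempotentElem.eq]))

theorem exists_projection_tau_le_add (hτ : IsNormalTrace N τ) (hp : p ∈ N)
    (hpp : IsStarProjection p) (hq : q ∈ N) (hqp : IsStarProjection q) :
    ∃ g ∈ N, IsStarProjection g ∧ p ≤ g ∧ q ≤ g ∧ τ g ≤ τ p + τ q := by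
  set X := (1 - p) * q with hX
  have hXN : X ∈ N := mul_mem (one_sub_mem hp) hq
  have hr := isStarProjection_rangeProj X
  have hpr : p * rangeProj X = 0 := by
    simpa using mul_rangeProj_eq_of_mul_eq (Y := p) (Z := 0)
      (by rw [hX, ← mul_assoc, hpp.mul_one_sub_self, zero_mul, zero_mul])
  have hrp : rangeProj X * p = 0 := by
    simpa [hr.isSelfAdjoint.star_eq, hpp.isSelfAdjoint.star_eq] using congr(star $hpr)
  have hg : IsStarProjection (p + rangeProj X) := hpp.add hr hpr
  refine ⟨p + rangeProj X, add_mem hp (rangeProj_mem hXN), hg,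
    le_add_of_nonneg_right hr.nonneg, (hqp.le_iff_mul_eq_right hg).2 ?_, ?_⟩
  · have hrq : rangeProj X * q = X := by
      have hmul := rangeProj_mul X
      rwa [hX, ← mul_assoc, mul_sub, mul_one, ← hX, hrp, sub_zero] at hmul
    rw [add_mul, hrq, hX, sub_mul, one_mul, add_sub_cancel]
  · rw [hτ.map_add p hp _ (rangeProj_mem hXN) hpp.nonneg hr.nonneg]
    gcongr
    exact tau_rangeProj_le hτ hXN hq hqp (by rw [hX, mul_assoc, hqp.isIdempotentElem.eq])

end Trace

section SpectralProjections

variable {H : Type*} [NormedAddCommGroup H] [InnerProductSpace ℂ H] [CompleteSpace H]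
  {A : H →L[ℂ] H} {f : ℝ → ℝ} {a b c C : ℝ}

/-- The positive part of `A - a` for a self-adjoint operator `A`. -/
noncomputable def excess (A : H →L[ℂ] H) (a : ℝ) : H →L[ℂ] H := cfc (fun x => max (x - a) 0) A

/-- The spectral projection of a self-adjoint operator `A` for the half-line `(a, ∞)`, encoded as
the range projection of `(A - a)₊`. -/
noncomputable def specProj (A : H →L[ℂ] H) (a : ℝ) : H →L[ℂ] H := rangeProj (excess A a)

theorem excess_nonneg (A : H →L[ℂ] H) (a : ℝ) : 0 ≤ excess A a :=
  cfc_nonneg fun _ _ => le_max_right _ _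

theorem excess_antitone (A : H →L[ℂ] H) : Antitone (excess A) := fun a b hab =>
  cfc_mono fun x _ => max_le_max (sub_le_sub_left hab x) le_rfl

theorem excess_eq_zero (h : ‖A‖ ≤ a) : excess A a = 0 := by
  nontriviality H →L[ℂ] H
  rw [← cfc_const_zero ℝ A]
  exact cfc_congr fun x hx =>
    max_eq_right (sub_nonpos.2 (((le_abs_self x).trans (spectrum.norm_le_norm_of_mem hx)).trans h))

theorem isStarProjection_specProj (A : H →L[ℂ] H) (a : ℝ) : IsStarProjection (specProj A a) :=
  isStarProjection_rangeProj _

theorem excess_mul_specProj (A : H →L[ℂ] H) (a : ℝ) : excess A a * specProj A a = excess A a := by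
  simpa [specProj, (isStarProjection_rangeProj (excess A a)).isSelfAdjoint.star_eq,
    (IsSelfAdjoint.of_nonneg (excess_nonneg A a)).star_eq] using
    congr(star $(rangeProj_mul (excess A a)))

theorem mul_specProj_eq_self_of_le {T : H →L[ℂ] H} (hT : 0 ≤ T) (h : T ≤ C • excess A a) :
    T * specProj A a = T := by
  have hzero := mul_eq_zero_of_nonneg_of_le (q := 1 - specProj A a) hT h
    (by rw [smul_mul_assoc, mul_sub, excess_mul_specProj, mul_one, sub_self, smul_zero])
  rw [mul_sub, mul_one, sub_eq_zero] at hzero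
  exact hzero.symm

theorem cfc_le_smul_excess (hf : Continuous f)
    (hle : ∀ x ∈ spectrum ℝ A, f x ≤ C * max (x - a) 0) : cfc f A ≤ C • excess A a := by
  rw [excess, ← cfc_const_mul C _ A (by fun_prop)]
  exact cfc_mono hle hf.continuousOn (by fun_prop)

theorem specProj_antitone (A : H →L[ℂ] H) : Antitone (specProj A) := by
  intro a b hab
  have hmul : excess A b * specProj A a = excess A b := mul_specProj_eq_self_of_le (C := 1)
    (excess_nonneg A b) (by rw [one_smul]; exact excess_antitone A hab)
  have hmul' : specProj A a * excess A b = 1 * excess A b := by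
    simpa [(isStarProjection_specProj A a).isSelfAdjoint.star_eq,
      (IsSelfAdjoint.of_nonneg (excess_nonneg A b)).star_eq] using congr(star $hmul)
  rw [(isStarProjection_specProj A b).le_iff_mul_eq_right (isStarProjection_specProj A a)]
  exact (mul_rangeProj_eq_of_mul_eq hmul').trans (one_mul _)

theorem specProj_eq_zero (h : ‖A‖ ≤ a) : specProj A a = 0 := by
  simpa [specProj] using mul_rangeProj_eq_of_mul_eq (X := excess A a) (Y := 1) (Z := 0)
    (by rw [excess_eq_zero h, mul_zero, mul_zero])

theorem cfc_le_smul_specProj (hA : IsSelfAdjoint A) (hf : Continuous f)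
    (h0 : ∀ x ∈ spectrum ℝ A, 0 ≤ f x) (hc : ∀ x ∈ spectrum ℝ A, f x ≤ c)
    (hle : ∀ x ∈ spectrum ℝ A, f x ≤ C * max (x - a) 0) : cfc f A ≤ c • specProj A a := by
  refine le_smul_of_mul_eq (isStarProjection_specProj A a) (cfc_predicate f A) ?_
    (mul_specProj_eq_self_of_le (cfc_nonneg h0) (cfc_le_smul_excess hf hle))
  rw [← Algebra.algebraMap_eq_smul_one]
  exact cfc_le_algebraMap f c A hc hf.continuousOn hA

theorem smul_specProj_le_cfc (hf : Continuous f) (hc : 0 ≤ c) (h0 : ∀ x ∈ spectrum ℝ A, 0 ≤ f x)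
    (hle : ∀ x ∈ spectrum ℝ A, a ≤ x → c ≤ f x) : c • specProj A a ≤ cfc f A := by
  have hmin : cfc (fun x => min (f x) c) A * specProj A a = c • specProj A a := by
    rw [← smul_one_mul c (specProj A a)]
    refine mul_rangeProj_eq_of_mul_eq ?_
    rw [excess, ← cfc_mul _ _ A (by fun_prop) (by fun_prop), smul_one_mul,
      ← cfc_const_mul c _ A (by fun_prop)]
    refine cfc_congr fun x hx => ?_
    rcases le_total a x with h | h
    · simp only [min_eq_right (hle x hx h)]
    · simp only [max_eq_right (sub_nonpos.2 h), mul_zero]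
  calc c • specProj A a ≤ cfc (fun x => min (f x) c) A :=
        smul_le_of_mul_eq (isStarProjection_specProj A a)
          (cfc_nonneg fun x hx => le_min (h0 x hx) hc) hmin
    _ ≤ cfc f A := cfc_mono fun x _ => min_le_left _ _

theorem norm_cfc_mul_one_sub_specProj_le (hab : a < b) (hf : Continuous f) (hc : 0 ≤ c)
    (h0 : ∀ x ∈ spectrum ℝ A, 0 ≤ f x) (hle : ∀ x ∈ spectrum ℝ A, x ≤ b → f x ≤ c) :
    ‖cfc f A * (1 - specProj A a)‖ ≤ c := by
  obtain ⟨M, hM⟩ := (spectrum.isCompact (𝕜 := ℝ) A).bddAbove_image hf.continuousOn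
  have hexcess : ∀ x ∈ spectrum ℝ A, max (f x - c) 0 ≤ |M| / (b - a) * max (x - a) 0 := by
    intro x hx
    have hba : 0 < b - a := sub_pos.2 hab
    rcases le_total x b with h | h
    · rw [max_eq_right (sub_nonpos.2 (hle x hx h))]
      positivity
    · rw [div_mul_eq_mul_div, le_div_iff₀ hba]
      refine mul_le_mul (max_le ?_ (abs_nonneg M))
        (le_max_of_le_left (sub_le_sub_right h a)) hba.le (abs_nonneg M)
      linarith [hM (mem_image_of_mem f hx), le_abs_self M]
  have hcut : cfc (fun x => max (f x - c) 0) A * specProj A a = cfc (fun x => max (f x - c) 0) A :=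
    mul_specProj_eq_self_of_le (cfc_nonneg fun _ _ => le_max_right _ _)
      (cfc_le_smul_excess (by fun_prop) hexcess)
  have hsplit : cfc f A = cfc (fun x => min (f x) c) A + cfc (fun x => max (f x - c) 0) A := by
    rw [← cfc_add A _ _ (by fun_prop) (by fun_prop)]
    refine cfc_congr fun x _ => ?_
    rw [← sub_self c, max_sub_sub_right, ← add_sub_assoc, min_add_max, add_sub_cancel_right]
  have hmin : ‖cfc (fun x => min (f x) c) A‖ ≤ c := by
    refine norm_cfc_le hc fun x hx => ?_
    rw [Real.norm_of_nonneg (le_min (h0 x hx) hc)]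
    exact min_le_right _ _
  calc ‖cfc f A * (1 - specProj A a)‖ = ‖cfc (fun x => min (f x) c) A * (1 - specProj A a)‖ := by
        rw [hsplit, add_mul, mul_sub (cfc (fun x => max (f x - c) 0) A), hcut, mul_one, sub_self,
          add_zero]
    _ ≤ c := (norm_mul_le_of_isStarProjection (isStarProjection_specProj A a).one_sub _).trans hmin

theorem norm_specProj_mul_lt_one {p : H →L[ℂ] H} (hA : IsSelfAdjoint A) (h : ‖A * p‖ < a) :
    ‖specProj A a * p‖ < 1 := by
  have ha : 0 < a := (norm_nonneg _).trans_lt h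
  have he := isStarProjection_specProj A a
  have hsq : a ^ 2 • specProj A a ≤ star A * A := by
    rw [hA.star_eq, ← sq, ← cfc_pow_id (R := ℝ) A 2]
    exact smul_specProj_le_cfc (by fun_prop) (by positivity) (fun x _ => sq_nonneg x)
      fun x _ hx => pow_le_pow_left₀ ha.le hx 2
  have hstar : star (a • specProj A a) * (a • specProj A a) = a ^ 2 • specProj A a := by
    rw [star_smul, he.isSelfAdjoint.star_eq, smul_mul_smul_comm, he.isIdempotentElem.eq, sq,
      star_trivial]
  have hnorm := norm_mul_le_of_star_mul_self_le (hstar.trans_le hsq) p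
  rw [smul_mul_assoc, norm_smul, Real.norm_of_nonneg ha.le] at hnorm
  exact (mul_lt_iff_lt_one_right ha).1 (hnorm.trans_lt h)

variable {N : VonNeumannAlgebra H} {τ : (H →L[ℂ] H) → ℝ≥0∞}

theorem excess_mem (hA : A ∈ N) (a : ℝ) : excess A a ∈ N := cfc_mem hA _

theorem specProj_mem (hA : A ∈ N) (a : ℝ) : specProj A a ∈ N := rangeProj_mem (excess_mem hA a)

theorem tau_specProj_antitone (hτ : IsNormalTrace N τ) (hA : A ∈ N) :
    Antitone fun a => τ (specProj A a) := fun a b hab =>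
  tau_mono hτ (specProj_mem hA b) (specProj_mem hA a) (isStarProjection_specProj A b).nonneg
    (specProj_antitone A hab)

end SpectralProjections

section SingularValues

variable {H : Type*} [NormedAddCommGroup H] [InnerProductSpace ℂ H] [CompleteSpace H]
  {N : VonNeumannAlgebra H} {τ : (H →L[ℂ] H) → ℝ≥0∞} {A B p : H →L[ℂ] H} {s t a c : ℝ}

theorem singularValue_nonneg (N : VonNeumannAlgebra H) (τ : (H →L[ℂ] H) → ℝ≥0∞) (A : H →L[ℂ] H)
    (t : ℝ) : 0 ≤ singularValue N τ A t :=
  Real.sInf_nonneg (by rintro _ ⟨p, -, -, -, rfl⟩; exact norm_nonneg _)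

theorem singularValue_le (hp : p ∈ N) (hpp : IsStarProjection p)
    (ht : τ (1 - p) ≤ ENNReal.ofReal t) : singularValue N τ A t ≤ ‖A * p‖ :=
  csInf_le ⟨0, by rintro _ ⟨p, -, -, -, rfl⟩; exact norm_nonneg _⟩ ⟨p, hp, hpp, ht, rfl⟩

theorem singularValue_le_norm (hτ : IsNormalTrace N τ) (A : H →L[ℂ] H) (t : ℝ) :
    singularValue N τ A t ≤ ‖A‖ := by
  simpa using singularValue_le (A := A) (t := t) (one_mem N) (.one _) (by simp [tau_zero hτ])

theorem exists_of_singularValue_lt (hτ : IsNormalTrace N τ) (h : singularValue N τ A t < c) :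
    ∃ p ∈ N, IsStarProjection p ∧ τ (1 - p) ≤ ENNReal.ofReal t ∧ ‖A * p‖ < c := by
  obtain ⟨_, ⟨p, hp, hpp, ht, rfl⟩, hlt⟩ :=
    exists_lt_of_csInf_lt (by exact ⟨_, 1, one_mem N, .one _, by simp [tau_zero hτ], rfl⟩) h
  exact ⟨p, hp, hpp, ht, hlt⟩

theorem singularValue_le_of_forall_exists (hτ : IsNormalTrace N τ)
    (h : ∀ p ∈ N, IsStarProjection p → τ (1 - p) ≤ ENNReal.ofReal t →
      ∃ q ∈ N, IsStarProjection q ∧ τ (1 - q) ≤ ENNReal.ofReal s ∧ ‖B * q‖ ≤ ‖A * p‖) :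
    singularValue N τ B s ≤ singularValue N τ A t := by
  refine le_of_forall_gt fun c hc => ?_
  obtain ⟨p, hp, hpp, ht, hlt⟩ := exists_of_singularValue_lt hτ hc
  obtain ⟨q, hq, hqp, hs, hle⟩ := h p hp hpp ht
  exact ((singularValue_le hq hqp hs).trans hle).trans_lt hlt

theorem singularValue_antitone (hτ : IsNormalTrace N τ) (A : H →L[ℂ] H) :
    Antitone (singularValue N τ A) := fun _ _ hst =>
  singularValue_le_of_forall_exists hτ fun p hp hpp hs =>
    ⟨p, hp, hpp, hs.trans (ENNReal.ofReal_le_ofReal hst), le_rfl⟩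

theorem singularValue_le_of_star_mul_self_le (hτ : IsNormalTrace N τ)
    (h : star B * B ≤ star A * A) (t : ℝ) : singularValue N τ B t ≤ singularValue N τ A t :=
  singularValue_le_of_forall_exists hτ fun p hp hpp ht =>
    ⟨p, hp, hpp, ht, norm_mul_le_of_star_mul_self_le h p⟩

theorem singularValue_star_le (hτ : IsNormalTrace N τ) (hA : A ∈ N) (t : ℝ) :
    singularValue N τ (star A) t ≤ singularValue N τ A t := by
  refine singularValue_le_of_forall_exists hτ fun p hp hpp ht => ?_
  set X := A * (1 - p) with hX
  have hXN : X ∈ N := mul_mem hA (one_sub_mem hp)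
  have hr := isStarProjection_rangeProj X
  refine ⟨1 - rangeProj X, one_sub_mem (rangeProj_mem hXN), hr.one_sub, ?_, ?_⟩
  · rw [sub_sub_cancel]
    exact (tau_rangeProj_le hτ hXN (one_sub_mem hp) hpp.one_sub
      (by rw [hX, mul_assoc, hpp.one_sub.isIdempotentElem.eq])).trans ht
  · have hcut : (1 - rangeProj X) * A = (1 - rangeProj X) * (A * p) := by
      rw [← sub_eq_zero, ← mul_sub, ← mul_one_sub, ← hX, sub_mul, one_mul, rangeProj_mul,
        sub_self]
    calc ‖star A * (1 - rangeProj X)‖ = ‖(1 - rangeProj X) * A‖ := by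
          rw [← norm_star, star_mul, star_star, hr.one_sub.isSelfAdjoint.star_eq]
      _ ≤ ‖A * p‖ := hcut ▸ norm_mul_le_of_isStarProjection_left hr.one_sub _

theorem singularValue_star (hτ : IsNormalTrace N τ) (hA : A ∈ N) (t : ℝ) :
    singularValue N τ (star A) t = singularValue N τ A t :=
  (singularValue_star_le hτ hA t).antisymm
    (by simpa only [star_star] using singularValue_star_le hτ (star_mem hA) t)

theorem singularValue_add_le (hτ : IsNormalTrace N τ) (A B : H →L[ℂ] H) (hs : 0 ≤ s)
    (ht : 0 ≤ t) :
    singularValue N τ (A + B) (s + t) ≤ singularValue N τ A s + singularValue N τ B t := by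
  refine le_of_forall_gt_imp_ge_of_dense fun c hc => ?_
  obtain ⟨a, ha, b, hb, rfl⟩ : ∃ a, singularValue N τ A s < a ∧ ∃ b, singularValue N τ B t < b ∧
      a + b = c :=
    ⟨(singularValue N τ A s + (c - singularValue N τ B t)) / 2, by linarith,
      (singularValue N τ B t + (c - singularValue N τ A s)) / 2, by linarith, by ring⟩
  obtain ⟨p, hp, hpp, hps, hpa⟩ := exists_of_singularValue_lt hτ ha
  obtain ⟨q, hq, hqp, hqt, hqb⟩ := exists_of_singularValue_lt hτ hb
  obtain ⟨g, hg, hgp, hpg, hqg, hgτ⟩ := exists_projection_tau_le_add hτ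
    (one_sub_mem hp) hpp.one_sub (one_sub_mem hq) hqp.one_sub
  have htrace : τ (1 - (1 - g)) ≤ ENNReal.ofReal (s + t) := by
    rw [sub_sub_cancel, ENNReal.ofReal_add hs ht]
    exact hgτ.trans (add_le_add hps hqt)
  calc singularValue N τ (A + B) (s + t) ≤ ‖(A + B) * (1 - g)‖ :=
        singularValue_le (one_sub_mem hg) hgp.one_sub htrace
    _ ≤ ‖A * (1 - g)‖ + ‖B * (1 - g)‖ := by rw [add_mul]; exact norm_add_le _ _
    _ ≤ ‖A * p‖ + ‖B * q‖ := add_le_add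
        (norm_mul_le_norm_mul_of_le hgp.one_sub hpp (sub_le_comm.1 hpg) A)
        (norm_mul_le_norm_mul_of_le hgp.one_sub hqp (sub_le_comm.1 hqg) B)
    _ ≤ a + b := add_le_add hpa.le hqb.le

theorem singularValue_smul_le (hτ : IsNormalTrace N τ) (c : ℂ) (A : H →L[ℂ] H) (t : ℝ) :
    singularValue N τ (c • A) t ≤ ‖c‖ * singularValue N τ A t := by
  rcases eq_or_ne c 0 with rfl | hc
  · simpa using singularValue_le_norm hτ (0 : H →L[ℂ] H) t
  have hc' : 0 < ‖c‖ := norm_pos_iff.2 hc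
  rw [← div_le_iff₀' hc']
  refine le_of_forall_gt_imp_ge_of_dense fun b hb => (div_le_iff₀' hc').2 ?_
  obtain ⟨p, hp, hpp, ht, hlt⟩ := exists_of_singularValue_lt hτ hb
  calc singularValue N τ (c • A) t ≤ ‖(c • A) * p‖ := singularValue_le hp hpp ht
    _ = ‖c‖ * ‖A * p‖ := by rw [smul_mul_assoc, norm_smul]
    _ ≤ ‖c‖ * b := by gcongr

theorem tau_specProj_le_of_singularValue_lt (hτ : IsNormalTrace N τ) (hA : A ∈ N)
    (hAs : IsSelfAdjoint A) (h : singularValue N τ A t < a) :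
    τ (specProj A a) ≤ ENNReal.ofReal t := by
  obtain ⟨p, hp, hpp, ht, hlt⟩ := exists_of_singularValue_lt hτ h
  exact (tau_le_of_norm_mul_lt_one hτ (specProj_mem hA a) (isStarProjection_specProj A a) hp hpp
    (norm_specProj_mul_lt_one hAs hlt)).trans ht

theorem singularValue_cfc_le_of_tau_specProj_le {f : ℝ → ℝ} {b : ℝ} (hA : A ∈ N) (hA0 : 0 ≤ A)
    (hf : Continuous f) (hmono : MonotoneOn f (Ici 0)) (h0 : 0 ≤ f 0)
    (h : τ (specProj A a) ≤ ENNReal.ofReal t) (hab : a < b) (hb : 0 ≤ b) :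
    singularValue N τ (cfc f A) t ≤ f b := by
  have hspec : ∀ x ∈ spectrum ℝ A, 0 ≤ x := fun x hx => spectrum_nonneg_of_nonneg hA0 hx
  have hf0 : ∀ x, 0 ≤ x → 0 ≤ f x := fun x hx => h0.trans (hmono self_mem_Ici hx hx)
  exact (singularValue_le (one_sub_mem (specProj_mem hA a)) (isStarProjection_specProj A a).one_sub
    (by rwa [sub_sub_cancel])).trans
      (norm_cfc_mul_one_sub_specProj_le hab hf (hf0 b hb) (fun x hx => hf0 x (hspec x hx))
        fun x hx hxb => hmono (hspec x hx) hb hxb)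

theorem singularValue_le_of_tau_specProj_le (hA : A ∈ N) (hA0 : 0 ≤ A) (ha : 0 ≤ a)
    (h : τ (specProj A a) ≤ ENNReal.ofReal t) : singularValue N τ A t ≤ a := by
  refine le_of_forall_gt_imp_ge_of_dense fun b hb => ?_
  simpa only [cfc_id' ℝ A] using singularValue_cfc_le_of_tau_specProj_le (f := fun x => x) hA hA0
    continuous_id monotoneOn_id le_rfl h hb (ha.trans hb.le)

theorem singularValue_cfc_le {f : ℝ → ℝ} (hτ : IsNormalTrace N τ) (hA : A ∈ N) (hA0 : 0 ≤ A)
    (hf : Continuous f) (hmono : MonotoneOn f (Ici 0)) (h0 : 0 ≤ f 0) (t : ℝ) :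
    singularValue N τ (cfc f A) t ≤ f (singularValue N τ A t) := by
  refine ge_of_tendsto (hf.continuousWithinAt (s := Ioi (singularValue N τ A t)))
    (eventually_mem_nhdsWithin.mono fun b hb => ?_)
  obtain ⟨a, ha, hab⟩ := exists_between (mem_Ioi.1 hb)
  exact singularValue_cfc_le_of_tau_specProj_le hA hA0 hf hmono h0
    (tau_specProj_le_of_singularValue_lt hτ hA (.of_nonneg hA0) ha) hab
    ((singularValue_nonneg N τ A t).trans hb.le)

theorem singularValue_rpow_le {p : ℝ} (hτ : IsNormalTrace N τ) (hA : A ∈ N) (hA0 : 0 ≤ A)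
    (hp : 0 < p) (t : ℝ) : singularValue N τ (A ^ p) t ≤ singularValue N τ A t ^ p := by
  rw [CFC.rpow_eq_cfc_real hA0]
  exact singularValue_cfc_le hτ hA hA0 (Real.continuous_rpow_const hp.le)
    (Real.monotoneOn_rpow_Ici_of_exponent_nonneg hp.le) (Real.rpow_nonneg le_rfl p) t

theorem singularValue_rpow {p : ℝ} (hτ : IsNormalTrace N τ) (hA : A ∈ N) (hA0 : 0 ≤ A)
    (hp : 0 < p) (t : ℝ) : singularValue N τ (A ^ p) t = singularValue N τ A t ^ p := by
  refine (singularValue_rpow_le hτ hA hA0 hp t).antisymm ?_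
  have hinv := singularValue_rpow_le hτ (rpow_mem hA p) CFC.rpow_nonneg (inv_pos.2 hp) t
  rw [CFC.rpow_rpow_of_exponent_nonneg A p p⁻¹ hp.le (inv_nonneg.2 hp.le) hA0,
    mul_inv_cancel₀ hp.ne', CFC.rpow_one A hA0] at hinv
  exact (Real.le_rpow_inv_iff_of_pos (singularValue_nonneg N τ A t)
    (singularValue_nonneg N τ (A ^ p) t) hp).1 hinv

end SingularValues

section StepIntegrals

variable {f F : ℝ → ℝ≥0∞} {a δ M : ℝ}

theorem setLIntegral_Ioi_eq_Ioc_add (f : ℝ → ℝ≥0∞) (a : ℝ) (hδ : 0 < δ) :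
    ∫⁻ x in Ioi a, f x = (∫⁻ x in Ioc a (a + δ), f x) + ∫⁻ x in Ioi (a + δ), f x := by
  rw [← lintegral_union measurableSet_Ioi (Ioc_disjoint_Ioi le_rfl),
    Ioc_union_Ioi_eq_Ioi (by linarith)]

theorem le_setLIntegral_Ioi_of_antitone (hf : Antitone f) (a : ℝ) (hδ : 0 < δ) :
    ENNReal.ofReal δ * f (a + δ) + ∫⁻ x in Ioi (a + δ), f x ≤ ∫⁻ x in Ioi a, f x := by
  rw [setLIntegral_Ioi_eq_Ioc_add f a hδ]
  gcongr
  calc ENNReal.ofReal δ * f (a + δ) = ∫⁻ _ in Ioc a (a + δ), f (a + δ) := by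
        rw [setLIntegral_const, Real.volume_Ioc, add_sub_cancel_left, mul_comm]
    _ ≤ ∫⁻ x in Ioc a (a + δ), f x := setLIntegral_mono' measurableSet_Ioc fun x hx => hf hx.2

theorem setLIntegral_Ioi_le_of_antitone (hf : Antitone f) (a : ℝ) (hδ : 0 < δ) :
    ∫⁻ x in Ioi a, f x ≤ ENNReal.ofReal δ * f a + ∫⁻ x in Ioi (a + δ), f x := by
  rw [setLIntegral_Ioi_eq_Ioc_add f a hδ]
  gcongr
  calc ∫⁻ x in Ioc a (a + δ), f x ≤ ∫⁻ _ in Ioc a (a + δ), f a :=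
        setLIntegral_mono' measurableSet_Ioc fun x hx => hf hx.1.le
    _ = ENNReal.ofReal δ * f a := by
        rw [setLIntegral_const, Real.volume_Ioc, add_sub_cancel_left, mul_comm]

theorem exists_le_add_nat_mul (M a : ℝ) (hδ : 0 < δ) : ∃ n : ℕ, M ≤ a + n * δ := by
  obtain ⟨n, hn⟩ := exists_nat_ge ((M - a) / δ)
  exact ⟨n, by linarith [(div_le_iff₀ hδ).1 hn]⟩

theorem le_setLIntegral_Ioi_of_step (hf : Antitone f) (hδ : 0 < δ)
    (hstep : ∀ x, F x ≤ ENNReal.ofReal δ * f x + F (x + δ)) (hM : ∀ x, M ≤ x → F x = 0) (a : ℝ) :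
    F (a + δ) ≤ ∫⁻ x in Ioi a, f x := by
  obtain ⟨n, hn⟩ := exists_le_add_nat_mul M a hδ
  induction n generalizing a with
  | zero => simp only [hM (a + δ) (by simp at hn; linarith), zero_le]
  | succ n ih =>
    calc F (a + δ) ≤ ENNReal.ofReal δ * f (a + δ) + F (a + δ + δ) := hstep (a + δ)
      _ ≤ ENNReal.ofReal δ * f (a + δ) + ∫⁻ x in Ioi (a + δ), f x := by
          gcongr
          exact ih (a + δ) (by push_cast at hn; linarith)
      _ ≤ ∫⁻ x in Ioi a, f x := le_setLIntegral_Ioi_of_antitone hf a hδ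

theorem setLIntegral_Ioi_le_of_step (hf : Antitone f) (hδ : 0 < δ)
    (hstep : ∀ x, ENNReal.ofReal δ * f (x + δ) + F (x + δ) ≤ F x) (hM : ∀ x, M ≤ x → f x = 0)
    (a : ℝ) : ∫⁻ x in Ioi (a + δ), f x ≤ F a := by
  obtain ⟨n, hn⟩ := exists_le_add_nat_mul M a hδ
  induction n generalizing a with
  | zero =>
    have hvanish : ∫⁻ x in Ioi (a + δ), f x = 0 := setLIntegral_eq_zero measurableSet_Ioi
      fun x hx => hM x (by simp at hn; linarith [mem_Ioi.1 hx])
    simp only [hvanish, zero_le]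
  | succ n ih =>
    calc ∫⁻ x in Ioi (a + δ), f x
        ≤ ENNReal.ofReal δ * f (a + δ) + ∫⁻ x in Ioi (a + δ + δ), f x :=
          setLIntegral_Ioi_le_of_antitone hf (a + δ) hδ
      _ ≤ ENNReal.ofReal δ * f (a + δ) + F (a + δ) := by
          gcongr
          exact ih (a + δ) (by push_cast at hn; linarith)
      _ ≤ F a := hstep a

theorem setLIntegral_Ioi_le_of_forall_pos {c : ℝ≥0∞}
    (h : ∀ δ, 0 < δ → ∫⁻ x in Ioi (a + δ), f x ≤ c) : ∫⁻ x in Ioi a, f x ≤ c := by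
  obtain ⟨u, hu, hpos, hlim⟩ := exists_seq_strictAnti_tendsto (0 : ℝ)
  have hunion : ⋃ n, Ioi (a + u n) = Ioi a := by
    ext x
    refine ⟨fun hx => ?_, fun hx => ?_⟩
    · obtain ⟨n, hn⟩ := mem_iUnion.1 hx
      exact (lt_add_of_pos_right a (hpos n)).trans hn
    · obtain ⟨n, hn⟩ := (hlim.eventually (gt_mem_nhds (sub_pos.2 (mem_Ioi.1 hx)))).exists
      exact mem_iUnion.2 ⟨n, lt_sub_iff_add_lt'.1 hn⟩
  have hmono : Monotone fun n => Ioi (a + u n) := fun m n hmn =>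
    Ioi_subset_Ioi (add_le_add_right (hu.antitone hmn) a)
  rw [← hunion, setLIntegral_iUnion_of_directed f hmono.directed_le]
  exact iSup_le fun n => h (u n) (hpos n)

theorem volume_setOf_pos_ofReal_lt (c : ℝ≥0∞) :
    volume {t : ℝ | 0 < t ∧ ENNReal.ofReal t < c} = c := by
  rcases eq_or_ne c ∞ with rfl | hc
  · simp only [ENNReal.ofReal_lt_top, and_true]
    exact Real.volume_Ioi
  · have hIoo : {t : ℝ | 0 < t ∧ ENNReal.ofReal t < c} = Ioo 0 c.toReal := by
      ext t
      exact and_congr_right fun ht => ENNReal.ofReal_lt_iff_lt_toReal ht.le hc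
    rw [hIoo, Real.volume_Ioo, sub_zero, ENNReal.ofReal_toReal hc]

end StepIntegrals

section TraceFormula

variable {H : Type*} [NormedAddCommGroup H] [InnerProductSpace ℂ H] [CompleteSpace H]
  {N : VonNeumannAlgebra H} {τ : (H →L[ℂ] H) → ℝ≥0∞} {A : H →L[ℂ] H} {δ : ℝ}

theorem excess_zero (hA0 : 0 ≤ A) : excess A 0 = A := by
  conv_rhs => rw [← cfc_id' ℝ A]
  exact cfc_congr fun x hx => by simp [spectrum_nonneg_of_nonneg hA0 hx]

theorem norm_excess_sub_le (hA0 : 0 ≤ A) (hδ : 0 ≤ δ) : ‖excess A δ - A‖ ≤ δ := by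
  have hsub : excess A δ - A = cfc (fun x => max (x - δ) 0 - x) A := by
    rw [cfc_sub _ _ A (by fun_prop) (by fun_prop), cfc_id' ℝ A, excess]
  rw [hsub]
  refine norm_cfc_le hδ fun x hx => ?_
  have hx0 : 0 ≤ x := spectrum_nonneg_of_nonneg hA0 hx
  rw [Real.norm_eq_abs, abs_le]
  constructor
  · linarith [le_max_left (x - δ) 0]
  · linarith [max_le (by linarith : x - δ ≤ x) hx0]

theorem excess_eq_add (A : H →L[ℂ] H) (a : ℝ) (hδ : 0 < δ) :
    excess A a = cfc (fun x => min (max (x - a) 0) δ) A + excess A (a + δ) := by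
  rw [excess, excess, ← cfc_add A _ _ (by fun_prop) (by fun_prop)]
  refine cfc_congr fun x _ => ?_
  rcases le_total x (a + δ) with h | h
  · simp only [max_eq_right (by linarith : x - (a + δ) ≤ 0), add_zero,
      min_eq_left (max_le (by linarith : x - a ≤ δ) hδ.le)]
  · simp only [max_eq_left (by linarith : 0 ≤ x - (a + δ)), max_eq_left (by linarith : 0 ≤ x - a),
      min_eq_right (by linarith : δ ≤ x - a)]
    ring

theorem tau_excess_eq_add (hτ : IsNormalTrace N τ) (hA : A ∈ N) (a : ℝ) (hδ : 0 < δ) :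
    τ (excess A a) = τ (cfc (fun x => min (max (x - a) 0) δ) A) + τ (excess A (a + δ)) := by
  rw [excess_eq_add A a hδ, hτ.map_add _ (cfc_mem hA _) _ (excess_mem hA _)
    (cfc_nonneg fun x _ => le_min (le_max_right _ _) hδ.le) (excess_nonneg A _)]

theorem tau_excess_le (hτ : IsNormalTrace N τ) (hA : A ∈ N) (hAs : IsSelfAdjoint A) (a : ℝ)
    (hδ : 0 < δ) :
    τ (excess A a) ≤ ENNReal.ofReal δ * τ (specProj A a) + τ (excess A (a + δ)) := by
  have hψ : ∀ x ∈ spectrum ℝ A, 0 ≤ min (max (x - a) 0) δ := fun x _ =>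
    le_min (le_max_right _ _) hδ.le
  rw [tau_excess_eq_add hτ hA a hδ,
    ← hτ.map_smul δ hδ.le _ (specProj_mem hA a) (isStarProjection_specProj A a).nonneg]
  gcongr
  exact tau_mono hτ (cfc_mem hA _) (real_smul_mem δ (specProj_mem hA a)) (cfc_nonneg hψ)
    (cfc_le_smul_specProj (C := 1) hAs (by fun_prop) hψ (fun x _ => min_le_right _ _)
      fun x _ => (min_le_left _ _).trans_eq (one_mul _).symm)

theorem add_tau_excess_le (hτ : IsNormalTrace N τ) (hA : A ∈ N) (a : ℝ) (hδ : 0 < δ) :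
    ENNReal.ofReal δ * τ (specProj A (a + δ)) + τ (excess A (a + δ)) ≤ τ (excess A a) := by
  have hproj := (isStarProjection_specProj A (a + δ)).nonneg
  rw [tau_excess_eq_add hτ hA a hδ, ← hτ.map_smul δ hδ.le _ (specProj_mem hA _) hproj]
  gcongr
  exact tau_mono hτ (real_smul_mem δ (specProj_mem hA _)) (cfc_mem hA _)
    (smul_nonneg hδ.le hproj) (smul_specProj_le_cfc (by fun_prop) hδ.le
      (fun x _ => le_min (le_max_right _ _) hδ.le)
      fun x _ hx => le_min (le_max_of_le_left (by linarith)) le_rfl)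

theorem tau_le_of_forall_tau_excess_le (hτ : IsNormalTrace N τ) (hA : A ∈ N) (hA0 : 0 ≤ A)
    {c : ℝ≥0∞} (h : ∀ δ, 0 < δ → τ (excess A δ) ≤ c) : τ A ≤ c := by
  obtain ⟨u, hu, hpos, hlim⟩ := exists_seq_strictAnti_tendsto (0 : ℝ)
  have hmono : Monotone fun n => excess A (u n) := fun m n hmn =>
    excess_antitone A (hu.antitone hmn)
  have htendsto : Tendsto (fun n => excess A (u n)) atTop (𝓝 A) :=
    tendsto_iff_norm_sub_tendsto_zero.2
      (squeeze_zero (fun _ => norm_nonneg _) (fun n => norm_excess_sub_le hA0 (hpos n).le) hlim)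
  exact tau_le_of_isLUB hτ hmono (fun n => excess_mem hA _) (fun n => excess_nonneg A _) hA
    (isLUB_of_tendsto_atTop hmono htendsto) fun n => h _ (hpos n)

theorem tau_eq_lintegral_specProj (hτ : IsNormalTrace N τ) (hA : A ∈ N) (hA0 : 0 ≤ A) :
    τ A = ∫⁻ x in Ioi 0, τ (specProj A x) := by
  have hanti := tau_specProj_antitone hτ hA
  refine le_antisymm (tau_le_of_forall_tau_excess_le hτ hA hA0 fun δ hδ => ?_)
    (setLIntegral_Ioi_le_of_forall_pos fun δ hδ => ?_)
  · simpa only [zero_add] using le_setLIntegral_Ioi_of_step (F := fun x => τ (excess A x)) hanti hδ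
      (fun x => tau_excess_le hτ hA (.of_nonneg hA0) x hδ)
      (fun x hx => by rw [excess_eq_zero hx, tau_zero hτ]) 0
  · simpa only [excess_zero hA0] using setLIntegral_Ioi_le_of_step (F := fun x => τ (excess A x))
      hanti hδ (fun x => add_tau_excess_le hτ hA x hδ)
      (fun x hx => by rw [specProj_eq_zero hx, tau_zero hτ]) 0

theorem lintegral_singularValue (hτ : IsNormalTrace N τ) (hA : A ∈ N) (hA0 : 0 ≤ A) :
    ∫⁻ t in Ioi 0, ENNReal.ofReal (singularValue N τ A t) = τ A := by
  have hnn : ∀ᵐ t ∂volume.restrict (Ioi (0 : ℝ)), 0 ≤ singularValue N τ A t :=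
    ae_of_all _ (singularValue_nonneg N τ A)
  have hmeas : Measurable (singularValue N τ A) := (singularValue_antitone hτ A).measurable
  rw [tau_eq_lintegral_specProj hτ hA hA0]
  apply le_antisymm
  · rw [lintegral_eq_lintegral_meas_lt _ hnn hmeas.aemeasurable]
    refine setLIntegral_mono' measurableSet_Ioi fun a ha => ?_
    rw [Measure.restrict_apply (measurableSet_lt measurable_const hmeas),
      ← volume_setOf_pos_ofReal_lt (τ (specProj A a))]
    exact measure_mono fun t ht => ⟨ht.2, lt_of_not_ge fun hle =>
      (singularValue_le_of_tau_specProj_le hA hA0 (le_of_lt ha) hle).not_gt ht.1⟩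
  · rw [lintegral_eq_lintegral_meas_le _ hnn hmeas.aemeasurable]
    refine setLIntegral_mono' measurableSet_Ioi fun a _ => ?_
    rw [Measure.restrict_apply (measurableSet_le measurable_const hmeas),
      ← volume_setOf_pos_ofReal_lt (τ (specProj A a))]
    exact measure_mono fun t ht => ⟨le_of_not_gt fun hlt =>
      (tau_specProj_le_of_singularValue_lt hτ hA (.of_nonneg hA0) hlt).not_gt ht.2, ht.1⟩

theorem tau_rpow_eq_lintegral {p : ℝ} (hτ : IsNormalTrace N τ) (hA : A ∈ N) (hA0 : 0 ≤ A)
    (hp : 0 < p) :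
    τ (A ^ p) = ∫⁻ t in Ioi 0, ENNReal.ofReal (singularValue N τ A t) ^ p := by
  rw [← lintegral_singularValue hτ (rpow_mem hA p) CFC.rpow_nonneg]
  simp only [singularValue_rpow hτ hA hA0 hp,
    ENNReal.ofReal_rpow_of_nonneg (singularValue_nonneg N τ A _) hp.le]

end TraceFormula

section Majorization

open scoped NNReal

variable {f g : ℝ → ℝ≥0∞}

theorem setLIntegral_le_of_isLowerSet
    (h : ∀ t, 0 < t → ∫⁻ s in Ioc 0 t, f s ≤ ∫⁻ s in Ioc 0 t, g s) {S : Set ℝ}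
    (hS : IsLowerSet S) (T : ℝ) :
    ∫⁻ s in S ∩ Ioc 0 T, f s ≤ ∫⁻ s in S ∩ Ioc 0 T, g s := by
  rcases (S ∩ Ioc 0 T).eq_empty_or_nonempty with hempty | ⟨x, hx⟩
  · simp only [hempty, Measure.restrict_empty, lintegral_zero_measure, le_refl]
  have hbdd : BddAbove (S ∩ Ioc 0 T) := ⟨T, fun y hy => hy.2.2⟩
  set c := sSup (S ∩ Ioc 0 T) 
  have hc0 : 0 < c := hx.2.1.trans_le (le_csSup hbdd hx)
  have houter : S ∩ Ioc 0 T ⊆ Ioc 0 c := fun y hy => ⟨hy.2.1, le_csSup hbdd hy⟩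
  have hinner : Ioo 0 c ⊆ S ∩ Ioc 0 T := fun y hy => by
    obtain ⟨z, hz, hyz⟩ := exists_lt_of_lt_csSup ⟨x, hx⟩ hy.2
    exact ⟨hS hyz.le hz.1, hy.1, hyz.le.trans hz.2.2⟩
  calc ∫⁻ s in S ∩ Ioc 0 T, f s ≤ ∫⁻ s in Ioc 0 c, f s := lintegral_mono_set houter
    _ ≤ ∫⁻ s in Ioc 0 c, g s := h c hc0
    _ = ∫⁻ s in Ioo 0 c, g s := setLIntegral_congr Ioo_ae_eq_Ioc.symm
    _ ≤ ∫⁻ s in S ∩ Ioc 0 T, g s := lintegral_mono_set hinner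

theorem setLIntegral_mul_eq_lintegral_superlevel {w : ℝ → ℝ≥0} (hf : Measurable f)
    (hw : Measurable w) (T : Set ℝ) :
    ∫⁻ s in T, f s * w s = ∫⁻ a in Ioi (0 : ℝ), ∫⁻ s in {s | a < w s} ∩ T, f s := by
  have hlayer := lintegral_eq_lintegral_meas_lt ((volume.restrict T).withDensity f)
    (f := fun s => (w s : ℝ)) (ae_of_all _ fun s => (w s).2) hw.coe_nnreal_real.aemeasurable
  simp only [ENNReal.ofReal_coe_nnreal] at hlayer
  rw [lintegral_withDensity_eq_lintegral_mul _ hf hw.coe_nnreal_ennreal] at hlayer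
  refine hlayer.trans (lintegral_congr fun a => ?_)
  have hmeas : MeasurableSet {s | a < w s} := measurableSet_lt measurable_const hw.coe_nnreal_real
  rw [withDensity_apply _ hmeas, Measure.restrict_restrict hmeas]

theorem setLIntegral_mul_antitone_le (hf : Measurable f) (hg : Measurable g)
    (h : ∀ t, 0 < t → ∫⁻ s in Ioc 0 t, f s ≤ ∫⁻ s in Ioc 0 t, g s) {w : ℝ → ℝ≥0}
    (hw : Antitone w) (T : ℝ) :
    ∫⁻ s in Ioc 0 T, f s * w s ≤ ∫⁻ s in Ioc 0 T, g s * w s := by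
  rw [setLIntegral_mul_eq_lintegral_superlevel hf hw.measurable,
    setLIntegral_mul_eq_lintegral_superlevel hg hw.measurable]
  refine lintegral_mono fun a => setLIntegral_le_of_isLowerSet h (fun x y hyx hx => ?_) T
  exact lt_of_lt_of_le hx (NNReal.coe_le_coe.2 (hw hyx))

theorem le_of_le_rpow_mul_rpow {p q : ℝ} (hpq : p.HolderConjugate q) {a b : ℝ≥0∞} (ha : a ≠ ∞)
    (h : a ≤ b ^ (1 / p) * a ^ (1 / q)) : a ≤ b := by
  rcases eq_or_ne a 0 with rfl | ha0
  · exact zero_le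
  have hsplit : a ^ (1 / p) * a ^ (1 / q) = a := by
    rw [← ENNReal.rpow_add _ _ ha0 ha, one_div, one_div, hpq.inv_add_inv_eq_one, ENNReal.rpow_one]
  rw [← ENNReal.rpow_le_rpow_iff (one_div_pos.2 hpq.pos),
    ← ENNReal.mul_le_mul_iff_left (ENNReal.rpow_pos (pos_iff_ne_zero.2 ha0) ha).ne'
      (ENNReal.rpow_ne_top_of_ne_zero ha0 ha), hsplit]
  exact h

variable {f : ℝ → ℝ≥0} {p : ℝ}

theorem setLIntegral_rpow_le_of_majorized (hf : Antitone f) (hg : Measurable g)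
    (h : ∀ t, 0 < t → ∫⁻ s in Ioc 0 t, (f s : ℝ≥0∞) ≤ ∫⁻ s in Ioc 0 t, g s) (hp : 1 < p) (T : ℝ) :
    ∫⁻ s in Ioc 0 T, (f s : ℝ≥0∞) ^ p ≤ ∫⁻ s in Ioc 0 T, g s ^ p := by
  have hp0 : 0 < p := one_pos.trans hp
  have hpq : p.HolderConjugate (p / (p - 1)) := Real.HolderConjugate.conjExponent hp
  set I := ∫⁻ s in Ioc 0 T, (f s : ℝ≥0∞) ^ p
  set J := ∫⁻ s in Ioc 0 T, g s ^ p
  have hI : I ≠ ∞ := by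
    refine ne_top_of_le_ne_top ?_ (setLIntegral_mono' (g := fun _ => (f 0 : ℝ≥0∞) ^ p)
      measurableSet_Ioc fun s hs => ENNReal.rpow_le_rpow (by exact_mod_cast hf hs.1.le) hp0.le)
    rw [setLIntegral_const]
    exact ENNReal.mul_ne_top (ENNReal.rpow_ne_top_of_nonneg hp0.le ENNReal.coe_ne_top) (by simp)
  have hw : Antitone fun s => f s ^ (p - 1) := fun s t hst =>
    NNReal.rpow_le_rpow (hf hst) (sub_nonneg.2 hp.le)
  have hcoe : ∀ s, ((f s ^ (p - 1) : ℝ≥0) : ℝ≥0∞) = (f s : ℝ≥0∞) ^ (p - 1) := fun s =>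
    ENNReal.coe_rpow_of_nonneg (f s) (sub_nonneg.2 hp.le)
  have hholder : I ≤ J ^ (1 / p) * I ^ (1 / (p / (p - 1))) := by
    calc I = ∫⁻ s in Ioc 0 T, (f s : ℝ≥0∞) * (f s ^ (p - 1) : ℝ≥0) := by
          refine lintegral_congr fun s => ?_
          rw [hcoe]
          nth_rw 2 [← ENNReal.rpow_one (f s : ℝ≥0∞)]
          rw [← ENNReal.rpow_add_of_nonneg _ _ zero_le_one (sub_nonneg.2 hp.le), add_sub_cancel]
      _ ≤ ∫⁻ s in Ioc 0 T, g s * (f s ^ (p - 1) : ℝ≥0) :=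
          setLIntegral_mul_antitone_le hf.measurable.coe_nnreal_ennreal hg h hw T
      _ ≤ J ^ (1 / p) * I ^ (1 / (p / (p - 1))) := by
          simp only [hcoe]
          exact ENNReal.lintegral_mul_rpow_le_lintegral_rpow_mul_lintegral_rpow hpq
            hg.aemeasurable hf.measurable.coe_nnreal_ennreal.aemeasurable
  exact le_of_le_rpow_mul_rpow hpq hI hholder

theorem lintegral_rpow_le_of_majorized (hf : Antitone f) (hg : Measurable g)
    (h : ∀ t, 0 < t → ∫⁻ s in Ioc 0 t, (f s : ℝ≥0∞) ≤ ∫⁻ s in Ioc 0 t, g s) (hp : 1 < p) :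
    ∫⁻ s in Ioi 0, (f s : ℝ≥0∞) ^ p ≤ ∫⁻ s in Ioi 0, g s ^ p := by
  have hunion : ⋃ n : ℕ, Ioc 0 (n : ℝ) = Ioi 0 := iUnion_Ioc_eq_Ioi_self_iff.2 fun x _ =>
    exists_nat_ge x
  rw [← hunion, setLIntegral_iUnion_of_directed, hunion]
  · exact iSup_le fun n => (setLIntegral_rpow_le_of_majorized hf hg h hp n).trans
      (lintegral_mono_set Ioc_subset_Ioi_self)
  · exact (show Monotone fun n : ℕ => Ioc 0 (n : ℝ) from fun m n hmn =>
      Ioc_subset_Ioc_right (by exact_mod_cast hmn)).directed_le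

end Majorization

section OperatorPowers

variable {𝒜 : Type*} [CStarAlgebra 𝒜] [PartialOrder 𝒜] [StarOrderedRing 𝒜] {a : 𝒜} {p x y : ℝ}

theorem rpowIntegrand₁₂_eq (p t x : ℝ) :
    Real.rpowIntegrand₁₂ p t x = t ^ (p - 1) * (t⁻¹ * x + t * (t + x)⁻¹ - 1) :=
  rfl

theorem cfc_rpowIntegrand₁₂ (p : ℝ) {t : ℝ} (ht : 0 < t) (ha : 0 ≤ a) :
    cfc (Real.rpowIntegrand₁₂ p t) a =
      t ^ (p - 1) • (t⁻¹ • a + t • Ring.inverse (algebraMap ℝ 𝒜 t + a) - 1) := by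
  have hne : ∀ r ∈ spectrum ℝ a, t + r ≠ 0 := fun r hr =>
    (add_pos_of_pos_of_nonneg ht (spectrum_nonneg_of_nonneg ha hr)).ne'
  have hinv : ContinuousOn (fun z : ℝ => (t + z)⁻¹) (spectrum ℝ a) :=
    .inv₀ (by fun_prop) hne
  have hlin : ContinuousOn (fun z : ℝ => t⁻¹ * z) (spectrum ℝ a) := by fun_prop
  have hmul : ContinuousOn (fun z : ℝ => t * (t + z)⁻¹) (spectrum ℝ a) :=
    continuousOn_const.mul hinv
  have hadd : ContinuousOn (fun z : ℝ => t⁻¹ * z + t * (t + z)⁻¹) (spectrum ℝ a) := hlin.add hmul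
  have hsub : ContinuousOn (fun z : ℝ => t⁻¹ * z + t * (t + z)⁻¹ - 1) (spectrum ℝ a) :=
    hadd.sub continuousOn_const
  rw [funext (rpowIntegrand₁₂_eq p t), cfc_const_mul _ _ a hsub,
    cfc_sub _ _ a hadd continuousOn_const, cfc_add a _ _ hlin hmul, cfc_const_mul t⁻¹ _ a,
    cfc_const_mul t _ a hinv, cfc_inv _ _ hne, cfc_const_add t _ a, cfc_id' ℝ a,
    cfc_const_one ℝ a]

theorem convexOn_cfc_rpowIntegrand₁₂ (p : ℝ) {t : ℝ} (ht : 0 < t) :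
    ConvexOn ℝ (Ici (0 : 𝒜)) (cfc (Real.rpowIntegrand₁₂ p t)) := by
  refine ConvexOn.congr ?_ fun a ha => (cfc_rpowIntegrand₁₂ p ht (mem_Ici.1 ha)).symm
  exact ((((convexOn_id (convex_Ici 0)).smul (by positivity)).add
    ((CStarAlgebra.convexOn_ringInverse_algebraMap_add ht).smul ht.le)).sub
      (concaveOn_const _ (convex_Ici 0))).smul (by positivity)

theorem continuousOn_rpowIntegrand₁₂ (hp : 1 < p) {t : ℝ} (ht : 0 < t) :
    ContinuousOn (Real.rpowIntegrand₁₂ p t) (Ici 0) :=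
  (Real.continuousOn_rpowIntegrand₁₂_uncurry hp (Ici 0) subset_rfl).uncurry_left t ht

theorem convexOn_rpow_of_mem_Ioo (hp : p ∈ Ioo 1 2) :
    ConvexOn ℝ (Ici (0 : 𝒜)) (fun a : 𝒜 => a ^ p) := by
  lift p to NNReal using by linarith [hp.1]
  have hp' : p ∈ Ioo 1 2 := by exact_mod_cast hp
  simp_rw [← CFC.nnrpow_eq_rpow (zero_lt_one.trans hp'.1)]
  obtain ⟨μ, hμ⟩ := CFC.exists_measure_nnrpow_eq_integral_cfcₙ_rpowIntegrand₁₂ 𝒜 hp'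
  refine ConvexOn.congr ?_ fun a ha => (hμ a ha).2.symm
  refine integral_convexOn_of_integrand_ae (convex_Ici _) ?_ fun a ha => (hμ a ha).1
  filter_upwards [ae_restrict_mem measurableSet_Ioi] with t ht
  refine (convexOn_cfc_rpowIntegrand₁₂ p ht).congr fun a ha => ?_
  exact (cfcₙ_eq_cfc (hf := (continuousOn_rpowIntegrand₁₂ hp.1 ht).mono fun z hz =>
    quasispectrum_nonneg_of_nonneg a (mem_Ici.1 ha) z hz)
      (hf0 := Real.rpowIntegrand₁₂_zero ht)).symm

theorem rpow_mul_rpow (a : 𝒜) (hx : 0 < x) (hy : 0 < y) : a ^ x * a ^ y = a ^ (x + y) := by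
  lift x to NNReal using hx.le
  lift y to NNReal using hy.le
  norm_cast at hx hy
  rw [← NNReal.coe_add, ← CFC.nnrpow_eq_rpow hx, ← CFC.nnrpow_eq_rpow hy,
    ← CFC.nnrpow_eq_rpow (add_pos hx hy), CFC.nnrpow_add hx hy]

theorem rpow_mul_self_mul_rpow (ha : 0 ≤ a) (hx : 0 < x) :
    a ^ (x / 2) * a * a ^ (x / 2) = a ^ (1 + x) := by
  conv_lhs => enter [1, 2]; rw [← CFC.rpow_one a ha]
  rw [rpow_mul_rpow a (half_pos hx) one_pos, rpow_mul_rpow a (by positivity) (half_pos hx)]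
  ring_nf

theorem rpow_half_mul_rpow_mul_rpow_half (a : 𝒜) (hx : 0 < x) :
    a ^ (1 / 2 : ℝ) * a ^ x * a ^ (1 / 2 : ℝ) = a ^ (1 + x) := by
  rw [rpow_mul_rpow a one_half_pos hx, rpow_mul_rpow a (by positivity) one_half_pos]
  ring_nf

theorem isSelfAdjoint_rpow (a : 𝒜) (x : ℝ) : IsSelfAdjoint (a ^ x) :=
  .of_nonneg CFC.rpow_nonneg

theorem smul_rpow (ha : 0 ≤ a) {c : ℝ} (hc : 0 ≤ c) (hp : 0 ≤ p) :
    (c • a) ^ p = c ^ p • a ^ p := by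
  have hcont : Continuous fun x : ℝ => x ^ p := Real.continuous_rpow_const hp
  have has : IsSelfAdjoint a := .of_nonneg ha
  calc (c • a) ^ p = cfc (fun x : ℝ => (c * x) ^ p) a := by
        rw [CFC.rpow_eq_cfc_real (smul_nonneg hc ha), ← cfc_id' ℝ a, ← cfc_const_mul c _ a,
          cfc_id' ℝ a, ← cfc_comp' (fun x : ℝ => x ^ p) _ a hcont.continuousOn]
    _ = cfc (fun x : ℝ => c ^ p * x ^ p) a :=
        cfc_congr fun x hx => Real.mul_rpow hc (spectrum_nonneg_of_nonneg ha hx)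
    _ = c ^ p • a ^ p := by
        rw [cfc_const_mul _ _ a hcont.continuousOn, CFC.rpow_eq_cfc_real ha]

theorem add_rpow_le {b : 𝒜} (ha : 0 ≤ a) (hb : 0 ≤ b) (hp : p ∈ Ioo 1 2) :
    (a + b) ^ p ≤ (2 : ℝ) ^ (p - 1) • (a ^ p + b ^ p) := by
  have hp0 : 0 ≤ p := by linarith [hp.1]
  have hconv : ((2 : ℝ)⁻¹ • a + (2 : ℝ)⁻¹ • b) ^ p ≤ (2 : ℝ)⁻¹ • a ^ p + (2 : ℝ)⁻¹ • b ^ p :=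
    (convexOn_rpow_of_mem_Ioo hp).2 ha hb (by norm_num) (by norm_num) (by norm_num)
  calc (a + b) ^ p = (2 : ℝ) ^ p • ((2 : ℝ)⁻¹ • a + (2 : ℝ)⁻¹ • b) ^ p := by
        rw [← smul_add, smul_rpow (add_nonneg ha hb) (by norm_num) hp0, smul_smul,
          ← Real.mul_rpow (by norm_num) (by norm_num), mul_inv_cancel₀ two_ne_zero, Real.one_rpow,
          one_smul]
    _ ≤ (2 : ℝ) ^ p • ((2 : ℝ)⁻¹ • a ^ p + (2 : ℝ)⁻¹ • b ^ p) :=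
        smul_le_smul_of_nonneg_left hconv (by positivity)
    _ = (2 : ℝ) ^ (p - 1) • (a ^ p + b ^ p) := by
        rw [← smul_add, smul_smul, Real.rpow_sub_one two_ne_zero, div_eq_mul_inv]

end OperatorPowers

section TraceOfPowers

variable {H : Type*} [NormedAddCommGroup H] [InnerProductSpace ℂ H] [CompleteSpace H]
  {N : VonNeumannAlgebra H} {τ : (H →L[ℂ] H) → ℝ≥0∞} {A B C : H →L[ℂ] H} {s : ℝ}

theorem tau_conj_rpow (hτ : IsNormalTrace N τ) (hA : A ∈ N) (hA0 : 0 ≤ A) (hC : C ∈ N)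
    (hs : 0 < s) :
    τ (C ^ (s / 2) * A * C ^ (s / 2)) = τ (A ^ (1 / 2 : ℝ) * C ^ s * A ^ (1 / 2 : ℝ)) := by
  have hA2 : A ^ (1 / 2 : ℝ) * A ^ (1 / 2 : ℝ) = A := by
    rw [rpow_mul_rpow A one_half_pos one_half_pos, add_halves, CFC.rpow_one A hA0]
  have hC2 : C ^ (s / 2) * C ^ (s / 2) = C ^ s := by
    rw [rpow_mul_rpow C (half_pos hs) (half_pos hs), add_halves]
  have htracial := hτ.tracial _ (mul_mem (rpow_mem hA (1 / 2)) (rpow_mem hC (s / 2)))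
  rw [star_mul, (isSelfAdjoint_rpow A _).star_eq, (isSelfAdjoint_rpow C _).star_eq] at htracial
  rw [← hC2]
  nth_rewrite 1 [← hA2]
  simpa only [mul_assoc] using htracial

theorem tau_rpow_le_tau_conj (hτ : IsNormalTrace N τ) (hA : A ∈ N) (hA0 : 0 ≤ A) (hC : C ∈ N)
    (hAC : A ≤ C) (hs : 0 < s) (hs1 : s ≤ 1) :
    τ (A ^ (1 + s)) ≤ τ (C ^ (s / 2) * A * C ^ (s / 2)) := by
  rw [tau_conj_rpow hτ hA hA0 hC hs, ← rpow_half_mul_rpow_mul_rpow_half A hs]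
  have hsa := isSelfAdjoint_rpow A (1 / 2)
  have hmem : ∀ X ∈ N, A ^ (1 / 2 : ℝ) * X * A ^ (1 / 2 : ℝ) ∈ N := fun X hX =>
    mul_mem (mul_mem (rpow_mem hA _) hX) (rpow_mem hA _)
  exact tau_mono hτ (hmem _ (rpow_mem hA s)) (hmem _ (rpow_mem hC s))
    (hsa.conjugate_nonneg CFC.rpow_nonneg)
    (hsa.conjugate_le_conjugate (CFC.rpow_le_rpow ⟨hs.le, hs1⟩ hAC))

theorem tau_rpow_add_tau_rpow_le (hτ : IsNormalTrace N τ) (hA : A ∈ N) (hA0 : 0 ≤ A) (hB : B ∈ N)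
    (hB0 : 0 ≤ B) (hs : 0 < s) (hs1 : s ≤ 1) :
    τ (A ^ (1 + s)) + τ (B ^ (1 + s)) ≤ τ ((A + B) ^ (1 + s)) := by
  set C := A + B
  have hCN : C ∈ N := add_mem hA hB
  have hmem : ∀ X ∈ N, C ^ (s / 2) * X * C ^ (s / 2) ∈ N := fun X hX =>
    mul_mem (mul_mem (rpow_mem hCN _) hX) (rpow_mem hCN _)
  have hsa := isSelfAdjoint_rpow C (s / 2)
  calc τ (A ^ (1 + s)) + τ (B ^ (1 + s))
      ≤ τ (C ^ (s / 2) * A * C ^ (s / 2)) + τ (C ^ (s / 2) * B * C ^ (s / 2)) :=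
        add_le_add
          (tau_rpow_le_tau_conj hτ hA hA0 hCN (le_add_of_nonneg_right hB0) hs hs1)
          (tau_rpow_le_tau_conj hτ hB hB0 hCN (le_add_of_nonneg_left hA0) hs hs1)
    _ = τ (C ^ (s / 2) * C * C ^ (s / 2)) := by
        rw [← hτ.map_add _ (hmem A hA) _ (hmem B hB) (hsa.conjugate_nonneg hA0)
          (hsa.conjugate_nonneg hB0), ← add_mul, ← mul_add]
    _ = τ (C ^ (1 + s)) := by rw [rpow_mul_self_mul_rpow (add_nonneg hA0 hB0) hs]

theorem tau_add_rpow_le (hτ : IsNormalTrace N τ) (hA : A ∈ N) (hA0 : 0 ≤ A) (hB : B ∈ N)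
    (hB0 : 0 ≤ B) (hs : 0 < s) (hs1 : s < 1) :
    τ ((A + B) ^ (1 + s)) ≤ ENNReal.ofReal (2 ^ s) * (τ (A ^ (1 + s)) + τ (B ^ (1 + s))) := by
  have hAp := rpow_mem hA (1 + s)
  have hBp := rpow_mem hB (1 + s)
  have hle := add_rpow_le hA0 hB0 (p := 1 + s) ⟨by linarith, by linarith⟩
  rw [add_sub_cancel_left] at hle
  rw [← hτ.map_add _ hAp _ hBp CFC.rpow_nonneg CFC.rpow_nonneg, ← hτ.map_smul _ (by positivity) _
    (add_mem hAp hBp) (add_nonneg CFC.rpow_nonneg CFC.rpow_nonneg)]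
  exact tau_mono hτ (rpow_mem (add_mem hA hB) _) (real_smul_mem _ (add_mem hAp hBp))
    CFC.rpow_nonneg hle

end TraceOfPowers

section DixmierIdeal

theorem star_posPart_mul_posPart_le {𝒜 : Type*} [CStarAlgebra 𝒜] [PartialOrder 𝒜]
    [StarOrderedRing 𝒜] {a : 𝒜} (ha : IsSelfAdjoint a) : star a⁺ * a⁺ ≤ star a * a := by
  have hsq : a * a = a⁺ * a⁺ + a⁻ * a⁻ := by
    nth_rewrite 1 2 [← CFC.posPart_sub_negPart a ha]
    rw [sub_mul, mul_sub, mul_sub, CFC.posPart_mul_negPart, CFC.negPart_mul_posPart]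
    abel
  rw [ha.star_eq, (IsSelfAdjoint.of_nonneg (CFC.posPart_nonneg a)).star_eq, hsq]
  exact le_add_of_nonneg_right
    (IsSelfAdjoint.of_nonneg (CFC.negPart_nonneg a)).mul_self_nonneg

variable {H : Type*} [NormedAddCommGroup H] [InnerProductSpace ℂ H] [CompleteSpace H]
  {N : VonNeumannAlgebra H} {τ : (H →L[ℂ] H) → ℝ≥0∞} {A B : H →L[ℂ] H} {t : ℝ}

theorem intervalIntegrable_singularValue (hτ : IsNormalTrace N τ) (A : H →L[ℂ] H) (a b : ℝ) :
    IntervalIntegrable (singularValue N τ A) volume a b :=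
  (singularValue_antitone hτ A).intervalIntegrable

theorem mem_dixmierIdeal_iff : A ∈ dixmierIdeal N τ ↔ A ∈ N ∧ ∃ C : ℝ, 1 ≤ C ∧
    ∀ t, 0 < t → ∫ s in (0 : ℝ)..t, singularValue N τ A s ≤ C * Real.log (1 + t) := by
  have log_pos : ∀ t : ℝ, 0 < t → 0 < Real.log (1 + t) := fun t ht => Real.log_pos (by linarith)
  refine and_congr_right fun _ => ⟨fun ⟨C, hC⟩ => ⟨max C 1, le_max_right _ _, fun t ht => ?_⟩,
    fun ⟨C, _, hC⟩ => ⟨C, fun t ht => ?_⟩⟩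
  · have hCt := hC t ht
    rw [one_div, inv_mul_le_iff₀ (log_pos t ht), mul_comm] at hCt
    exact hCt.trans (mul_le_mul_of_nonneg_right (le_max_left _ _) (log_pos t ht).le)
  · rw [one_div, inv_mul_le_iff₀ (log_pos t ht), mul_comm]
    exact hC t ht

theorem mem_dixmierIdeal_of_le (hτ : IsNormalTrace N τ) (hA : A ∈ dixmierIdeal N τ) (hB : B ∈ N)
    {K : ℝ} (hK : 0 ≤ K) (h : ∀ s, singularValue N τ B s ≤ K * singularValue N τ A s) :
    B ∈ dixmierIdeal N τ := by
  obtain ⟨-, C, hC⟩ := hA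
  refine ⟨hB, K * C, fun t ht => ?_⟩
  have hint : ∫ s in (0 : ℝ)..t, singularValue N τ B s ≤
      K * ∫ s in (0 : ℝ)..t, singularValue N τ A s := by
    rw [← intervalIntegral.integral_const_mul]
    exact intervalIntegral.integral_mono_on ht.le (intervalIntegrable_singularValue hτ B _ _)
      ((intervalIntegrable_singularValue hτ A _ _).const_mul K) fun s _ => h s
  have hlog : 0 ≤ 1 / Real.log (1 + t) := one_div_nonneg.2 (Real.log_nonneg (by linarith))
  calc 1 / Real.log (1 + t) * ∫ s in (0 : ℝ)..t, singularValue N τ B s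
      ≤ 1 / Real.log (1 + t) * (K * ∫ s in (0 : ℝ)..t, singularValue N τ A s) := by gcongr
    _ = K * (1 / Real.log (1 + t) * ∫ s in (0 : ℝ)..t, singularValue N τ A s) := by ring
    _ ≤ K * C := by gcongr; exact hC t ht

theorem integral_singularValue_half_le (hτ : IsNormalTrace N τ) (A : H →L[ℂ] H) (ht : 0 ≤ t) :
    ∫ s in (0 : ℝ)..t, singularValue N τ A (s / 2) ≤
      2 * ∫ s in (0 : ℝ)..t, singularValue N τ A s := by
  rw [intervalIntegral.integral_comp_div (singularValue N τ A) two_ne_zero, zero_div, smul_eq_mul]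
  gcongr
  exact intervalIntegral.integral_mono_interval le_rfl (by positivity) (by linarith)
    (ae_of_all _ fun s => singularValue_nonneg N τ A s)
    (intervalIntegrable_singularValue hτ A _ _)

theorem integral_singularValue_add_le (hτ : IsNormalTrace N τ) (A B : H →L[ℂ] H) (ht : 0 ≤ t) :
    ∫ s in (0 : ℝ)..t, singularValue N τ (A + B) s ≤
      2 * (∫ s in (0 : ℝ)..t, singularValue N τ A s) +
        2 * ∫ s in (0 : ℝ)..t, singularValue N τ B s := by
  have hint : ∀ C : H →L[ℂ] H,
      IntervalIntegrable (fun s => singularValue N τ C (s / 2)) volume 0 t := fun C =>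
    Antitone.intervalIntegrable fun s r hsr => singularValue_antitone hτ C (by linarith)
  calc ∫ s in (0 : ℝ)..t, singularValue N τ (A + B) s
      ≤ ∫ s in (0 : ℝ)..t, (singularValue N τ A (s / 2) + singularValue N τ B (s / 2)) := by
        refine intervalIntegral.integral_mono_on ht (intervalIntegrable_singularValue hτ _ _ _)
          ((hint A).add (hint B)) fun s hs => ?_
        have hs2 : 0 ≤ s / 2 := by linarith [hs.1]
        simpa only [add_halves] using singularValue_add_le hτ A B hs2 hs2
    _ ≤ _ := by
        rw [intervalIntegral.integral_add (hint A) (hint B)]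
        exact add_le_add (integral_singularValue_half_le hτ A ht)
          (integral_singularValue_half_le hτ B ht)

/-- The Dixmier ideal of a normal trace as a linear subspace of the bounded operators. -/
noncomputable def dixmierSubmodule (hτ : IsNormalTrace N τ) : Submodule ℂ (H →L[ℂ] H) where
  carrier := dixmierIdeal N τ
  zero_mem' := by
    have hzero : ∀ s, singularValue N τ (0 : H →L[ℂ] H) s = 0 := fun s =>
      le_antisymm (by simpa using singularValue_le_norm hτ (0 : H →L[ℂ] H) s)
        (singularValue_nonneg N τ _ s)
    exact ⟨zero_mem N, 0, fun t _ => by simp [hzero]⟩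
  add_mem' := by
    intro A B hA hB
    obtain ⟨hAN, C, hC1, hC⟩ := mem_dixmierIdeal_iff.1 hA
    obtain ⟨hBN, D, hD1, hD⟩ := mem_dixmierIdeal_iff.1 hB
    refine mem_dixmierIdeal_iff.2
      ⟨add_mem hAN hBN, 2 * C + 2 * D, by linarith, fun t ht => ?_⟩
    linarith [integral_singularValue_add_le hτ A B ht.le, hC t ht, hD t ht]
  smul_mem' c A hA := mem_dixmierIdeal_of_le hτ hA (N.toStarSubalgebra.smul_mem hA.1 c)
    (norm_nonneg c) (singularValue_smul_le hτ c A)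

theorem zero_mem_dixmierIdeal (hτ : IsNormalTrace N τ) : 0 ∈ dixmierIdeal N τ :=
  (dixmierSubmodule hτ).zero_mem

theorem add_mem_dixmierIdeal (hτ : IsNormalTrace N τ) (hA : A ∈ dixmierIdeal N τ)
    (hB : B ∈ dixmierIdeal N τ) : A + B ∈ dixmierIdeal N τ :=
  (dixmierSubmodule hτ).add_mem hA hB

theorem real_smul_mem_dixmierIdeal (hτ : IsNormalTrace N τ) (c : ℝ) (hA : A ∈ dixmierIdeal N τ) :
    c • A ∈ dixmierIdeal N τ :=
  (dixmierSubmodule hτ).smul_of_tower_mem c hA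

theorem star_mem_dixmierIdeal (hτ : IsNormalTrace N τ) (hA : A ∈ dixmierIdeal N τ) :
    star A ∈ dixmierIdeal N τ :=
  mem_dixmierIdeal_of_le hτ hA (star_mem hA.1) zero_le_one fun s => by
    rw [one_mul, singularValue_star hτ hA.1]

theorem posPart_mem_dixmierIdeal (hτ : IsNormalTrace N τ) (hA : A ∈ dixmierIdeal N τ)
    (hAs : IsSelfAdjoint A) : A⁺ ∈ dixmierIdeal N τ :=
  mem_dixmierIdeal_of_le hτ hA (posPart_mem hA.1) zero_le_one fun s =>
    (singularValue_le_of_star_mul_self_le hτ (star_posPart_mul_posPart_le hAs) s).trans_eq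
      (one_mul _).symm

end DixmierIdeal

section TraceBounds

theorem ofReal_intervalIntegral {f : ℝ → ℝ} {t : ℝ} (ht : 0 ≤ t)
    (hf : IntervalIntegrable f volume 0 t) (hf0 : ∀ s, 0 < s → 0 ≤ f s) :
    ENNReal.ofReal (∫ s in (0 : ℝ)..t, f s) = ∫⁻ s in Ioc 0 t, ENNReal.ofReal (f s) := by
  rw [intervalIntegral.integral_of_le ht, ofReal_integral_eq_lintegral_ofReal
    ((intervalIntegrable_iff_integrableOn_Ioc_of_le ht).1 hf)]
  filter_upwards [ae_restrict_mem measurableSet_Ioc] with s hs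
  exact hf0 s hs.1

theorem setLIntegral_div_one_add {C t : ℝ} (hC : 0 ≤ C) (ht : 0 ≤ t) :
    ∫⁻ u in Ioc 0 t, ENNReal.ofReal (C / (1 + u)) = ENNReal.ofReal (C * Real.log (1 + t)) := by
  have hint : IntervalIntegrable (fun u => C / (1 + u)) volume 0 t := by
    refine ContinuousOn.intervalIntegrable (continuousOn_const.div (by fun_prop) fun u hu => ?_)
    rw [uIcc_of_le ht] at hu
    linarith [hu.1]
  have hval : ∫ u in (0 : ℝ)..t, C / (1 + u) = C * Real.log (1 + t) := by
    simp only [div_eq_mul_inv]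
    rw [intervalIntegral.integral_const_mul,
      intervalIntegral.integral_comp_add_left (fun u : ℝ => u⁻¹),
      integral_inv_of_pos (by norm_num) (by linarith), add_zero, div_one]
  rw [← ofReal_intervalIntegral ht hint fun u hu => by positivity, hval]

theorem setLIntegral_Ioi_rpow {p c : ℝ} (hp : p < -1) (hc : 0 < c) :
    ∫⁻ u in Ioi c, ENNReal.ofReal (u ^ p) = ENNReal.ofReal (-c ^ (p + 1) / (p + 1)) := by
  rw [← integral_Ioi_rpow_of_lt hp hc,
    ofReal_integral_eq_lintegral_ofReal (integrableOn_Ioi_rpow_of_lt hp hc)]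
  filter_upwards [ae_restrict_mem measurableSet_Ioi] with u hu
  exact Real.rpow_nonneg (hc.trans hu).le _

theorem lintegral_div_one_add_rpow {C p : ℝ} (hC : 0 ≤ C) (hp : 1 < p) :
    ∫⁻ u in Ioi 0, ENNReal.ofReal (C / (1 + u)) ^ p = ENNReal.ofReal (C ^ p / (p - 1)) := by
  have hpre : (fun u : ℝ => 1 + u) ⁻¹' Ioi 1 = Ioi 0 := by simp
  calc ∫⁻ u in Ioi 0, ENNReal.ofReal (C / (1 + u)) ^ p
      = ∫⁻ u in Ioi 0, ENNReal.ofReal (C ^ p) * ENNReal.ofReal ((1 + u) ^ (-p)) := by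
        refine setLIntegral_congr_fun measurableSet_Ioi fun u hu => ?_
        have hu1 : 0 ≤ 1 + u := by linarith [mem_Ioi.1 hu]
        rw [ENNReal.ofReal_rpow_of_nonneg (by positivity) (by linarith), Real.div_rpow hC hu1,
          Real.rpow_neg hu1, div_eq_mul_inv, ENNReal.ofReal_mul (by positivity)]
    _ = ENNReal.ofReal (C ^ p) * ∫⁻ u in Ioi 1, ENNReal.ofReal (u ^ (-p)) := by
        rw [lintegral_const_mul _ (by fun_prop), ← hpre,
          (measurePreserving_add_left volume (1 : ℝ)).setLIntegral_comp_preimage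
            measurableSet_Ioi (by fun_prop) (f := fun u => ENNReal.ofReal (u ^ (-p)))]
    _ = ENNReal.ofReal (C ^ p / (p - 1)) := by
        rw [setLIntegral_Ioi_rpow (by linarith) one_pos, Real.one_rpow,
          ← ENNReal.ofReal_mul (by positivity), ← neg_sub p 1 |>.trans (by ring : _ = -p + 1),
          neg_div_neg_eq, mul_one_div]

variable {H : Type*} [NormedAddCommGroup H] [InnerProductSpace ℂ H] [CompleteSpace H]
  {N : VonNeumannAlgebra H} {τ : (H →L[ℂ] H) → ℝ≥0∞} {A B : H →L[ℂ] H} {C p t : ℝ}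

theorem setLIntegral_singularValue (hτ : IsNormalTrace N τ) (A : H →L[ℂ] H) (ht : 0 ≤ t) :
    ∫⁻ s in Ioc 0 t, ENNReal.ofReal (singularValue N τ A s) =
      ENNReal.ofReal (∫ s in (0 : ℝ)..t, singularValue N τ A s) :=
  (ofReal_intervalIntegral ht (intervalIntegrable_singularValue hτ A 0 t)
    fun s _ => singularValue_nonneg N τ A s).symm

theorem tau_rpow_le_lintegral {g : ℝ → ℝ≥0∞} (hτ : IsNormalTrace N τ) (hA : A ∈ N) (hA0 : 0 ≤ A)
    (hg : Measurable g) (hp : 1 < p) (h : ∀ t, 0 < t →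
      ENNReal.ofReal (∫ s in (0 : ℝ)..t, singularValue N τ A s) ≤ ∫⁻ s in Ioc 0 t, g s) :
    τ (A ^ p) ≤ ∫⁻ s in Ioi 0, g s ^ p := by
  rw [tau_rpow_eq_lintegral hτ hA hA0 (zero_lt_one.trans hp)]
  refine lintegral_rpow_le_of_majorized (f := fun s => (singularValue N τ A s).toNNReal)
    (fun s r hsr => Real.toNNReal_mono (singularValue_antitone hτ A hsr)) hg (fun t ht => ?_) hp
  exact (setLIntegral_singularValue hτ A ht.le).trans_le (h t ht)

theorem tau_rpow_le_of_majorized (hτ : IsNormalTrace N τ) (hA : A ∈ N) (hA0 : 0 ≤ A) (hB : B ∈ N)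
    (hB0 : 0 ≤ B) (h : Majorized N τ B A) (hp : 1 < p) : τ (B ^ p) ≤ τ (A ^ p) := by
  rw [tau_rpow_eq_lintegral hτ hA hA0 (zero_lt_one.trans hp)]
  refine tau_rpow_le_lintegral hτ hB hB0
    (singularValue_antitone hτ A).measurable.ennreal_ofReal hp fun t ht => ?_
  rw [setLIntegral_singularValue hτ A ht.le]
  exact ENNReal.ofReal_le_ofReal (h t ht.le)

theorem tau_rpow_le_of_integral_le_log (hτ : IsNormalTrace N τ) (hA : A ∈ N) (hA0 : 0 ≤ A)
    (hC0 : 0 ≤ C)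
    (hC : ∀ t, 0 < t → ∫ s in (0 : ℝ)..t, singularValue N τ A s ≤ C * Real.log (1 + t))
    (hp : 1 < p) : τ (A ^ p) ≤ ENNReal.ofReal (C ^ p / (p - 1)) := by
  rw [← lintegral_div_one_add_rpow hC0 hp]
  refine tau_rpow_le_lintegral hτ hA hA0 (by fun_prop) hp fun t ht => ?_
  rw [setLIntegral_div_one_add hC0 ht.le]
  exact ENNReal.ofReal_le_ofReal (hC t ht)

theorem tau_rpow_lt_top (hτ : IsNormalTrace N τ) (hA : A ∈ dixmierIdeal N τ) (hA0 : 0 ≤ A)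
    (hp : 1 < p) : τ (A ^ p) < ∞ := by
  obtain ⟨hAN, C, hC1, hC⟩ := mem_dixmierIdeal_iff.1 hA
  exact (tau_rpow_le_of_integral_le_log hτ hAN hA0 (zero_le_one.trans hC1) hC hp).trans_lt
    ENNReal.ofReal_lt_top

end TraceBounds

section ZetaOfPositive

variable {H : Type*} [NormedAddCommGroup H] [InnerProductSpace ℂ H] [CompleteSpace H]
  {N : VonNeumannAlgebra H} {τ : (H →L[ℂ] H) → ℝ≥0∞} {A B : H →L[ℂ] H} {γ : LInfty →ₗ[ℝ] ℝ}
  {c C : ℝ}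

theorem zetaFun_nonneg (τ : (H →L[ℂ] H) → ℝ≥0∞) (A : H →L[ℂ] H) (t : Ioi (0 : ℝ)) :
    0 ≤ zetaFun τ A t :=
  mul_nonneg (one_div_nonneg.2 t.2.le) ENNReal.toReal_nonneg

theorem one_lt_one_add_one_div (t : Ioi (0 : ℝ)) : 1 < 1 + 1 / (t : ℝ) :=
  lt_add_of_pos_right 1 (one_div_pos.2 t.2)

theorem measurable_zetaFun (hτ : IsNormalTrace N τ) (hA : A ∈ N) (hA0 : 0 ≤ A) :
    Measurable (zetaFun τ A) := by
  have hpow : Measurable fun x : Ioi (0 : ℝ) × ℝ =>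
      ENNReal.ofReal (singularValue N τ A x.2) ^ (1 + 1 / (x.1 : ℝ)) :=
    ((singularValue_antitone hτ A).measurable.comp measurable_snd).ennreal_ofReal.pow (by fun_prop)
  have hformula : zetaFun τ A = fun t : Ioi (0 : ℝ) => 1 / (t : ℝ) *
      (∫⁻ s in Ioi 0, ENNReal.ofReal (singularValue N τ A s) ^ (1 + 1 / (t : ℝ))).toReal := by
    ext t
    rw [zetaFun, tau_rpow_eq_lintegral hτ hA hA0 (zero_lt_one.trans (one_lt_one_add_one_div t))]
  rw [hformula]
  exact (by fun_prop : Measurable fun t : Ioi (0 : ℝ) => 1 / (t : ℝ)).mul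
    (hpow.lintegral_prod_right' (ν := volume.restrict (Ioi 0))).ennreal_toReal

theorem zetaFun_le_sq (hτ : IsNormalTrace N τ) (hA : A ∈ N) (hA0 : 0 ≤ A) (hC1 : 1 ≤ C)
    (hC : ∀ t, 0 < t → ∫ s in (0 : ℝ)..t, singularValue N τ A s ≤ C * Real.log (1 + t))
    {t : Ioi (0 : ℝ)} (ht : 1 ≤ (t : ℝ)) : zetaFun τ A t ≤ C ^ 2 := by
  have ht0 : (0 : ℝ) < t := t.2
  have hinv : 1 / (t : ℝ) ≤ 1 := (div_le_one ht0).2 ht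
  have hτA : (τ (A ^ (1 + 1 / (t : ℝ)))).toReal ≤ C ^ (1 + 1 / (t : ℝ)) * t := by
    refine ENNReal.toReal_le_of_le_ofReal (by positivity)
      ((tau_rpow_le_of_integral_le_log hτ hA hA0 (zero_le_one.trans hC1) hC
        (one_lt_one_add_one_div t)).trans_eq ?_)
    rw [add_sub_cancel_left, div_div_eq_mul_div, div_one]
  calc zetaFun τ A t ≤ 1 / (t : ℝ) * (C ^ (1 + 1 / (t : ℝ)) * t) :=
        mul_le_mul_of_nonneg_left hτA (by positivity)
    _ = C ^ (1 + 1 / (t : ℝ)) := by field_simp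
    _ ≤ C ^ (2 : ℝ) := Real.rpow_le_rpow_of_exponent_le hC1 (by linarith)
    _ = C ^ 2 := Real.rpow_two C

theorem exists_zetaFun_le (hτ : IsNormalTrace N τ) (hA : A ∈ dixmierIdeal N τ) (hA0 : 0 ≤ A) :
    ∃ C : ℝ, 0 ≤ C ∧ ∀ t : Ioi (0 : ℝ), 1 ≤ (t : ℝ) → zetaFun τ A t ≤ C := by
  obtain ⟨hAN, C, hC1, hC⟩ := mem_dixmierIdeal_iff.1 hA
  exact ⟨C ^ 2, sq_nonneg C, fun t => zetaFun_le_sq hτ hAN hA0 hC1 hC⟩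

theorem indicator_zetaFun_mem (hτ : IsNormalTrace N τ) (hA : A ∈ dixmierIdeal N τ) (hA0 : 0 ≤ A) :
    indicator {t : Ioi (0 : ℝ) | 1 ≤ (t : ℝ)} (zetaFun τ A) ∈ LInfty := by
  obtain ⟨C, hC0, hC⟩ := exists_zetaFun_le hτ hA hA0
  refine ⟨((measurable_zetaFun hτ hA.1 hA0).indicator
    (measurableSet_le measurable_const measurable_subtype_coe)).aemeasurable, C, fun t => ?_⟩
  rw [abs_of_nonneg (indicator_nonneg (fun s _ => zetaFun_nonneg τ A s) t)]
  exact indicator_apply_le' (hC t) fun _ => hC0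

theorem eventually_gt_coe_atTop (c : ℝ) : ∀ᶠ t : Ioi (0 : ℝ) in atTop, c < (t : ℝ) :=
  (tendsto_comp_val_Ioi_atTop.2 tendsto_id).eventually_gt_atTop c

theorem indicator_zetaFun_eventuallyEq (τ : (H →L[ℂ] H) → ℝ≥0∞) (A : H →L[ℂ] H) :
    indicator {t : Ioi (0 : ℝ) | 1 ≤ (t : ℝ)} (zetaFun τ A) =ᶠ[atTop] zetaFun τ A := by
  filter_upwards [eventually_gt_coe_atTop 1] with t ht
  exact indicator_of_mem (by exact ht.le) _

theorem exists_zetaPos_eq (hτ : IsNormalTrace N τ) (γ : LInfty →ₗ[ℝ] ℝ)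
    (hA : A ∈ dixmierIdeal N τ) (hA0 : 0 ≤ A) :
    ∃ z : LInfty, z.1 =ᶠ[atTop] zetaFun τ A ∧ zetaPos τ γ A = γ z :=
  ⟨⟨_, indicator_zetaFun_mem hτ hA hA0⟩, indicator_zetaFun_eventuallyEq τ A,
    dif_pos (indicator_zetaFun_mem hτ hA hA0)⟩

theorem zetaPos_eq_of_tendsto (hτ : IsNormalTrace N τ) (hγ : IsGeneralisedLimit γ)
    (hA : A ∈ dixmierIdeal N τ) (hA0 : 0 ≤ A) {z : LInfty}
    (hz : Tendsto (fun t => zetaFun τ A t - z.1 t) atTop (𝓝 0)) : zetaPos τ γ A = γ z := by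
  obtain ⟨w, hwA, hw⟩ := exists_zetaPos_eq hτ γ hA hA0
  rw [hw, ← sub_eq_zero, ← map_sub]
  refine hγ.vanish (w - z) (hz.congr' ?_)
  filter_upwards [hwA] with t ht
  exact congrArg (· - z.1 t) ht.symm

theorem zetaPos_eq_of_eventuallyEq (hτ : IsNormalTrace N τ) (hγ : IsGeneralisedLimit γ)
    (hA : A ∈ dixmierIdeal N τ) (hA0 : 0 ≤ A) {z : LInfty} (hz : z.1 =ᶠ[atTop] zetaFun τ A) :
    zetaPos τ γ A = γ z :=
  zetaPos_eq_of_tendsto hτ hγ hA hA0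
    (tendsto_const_nhds.congr' (hz.mono fun _ ht => (sub_eq_zero.2 ht.symm).symm))

theorem tendsto_rpow_one_div (hc : 0 < c) :
    Tendsto (fun t : Ioi (0 : ℝ) => c ^ (1 / (t : ℝ))) atTop (𝓝 1) := by
  have hinv : Tendsto (fun t : ℝ => 1 / t) atTop (𝓝 0) := by
    simpa only [one_div] using tendsto_inv_atTop_zero (𝕜 := ℝ)
  have hpow : Tendsto (fun t : ℝ => c ^ (1 / t)) atTop (𝓝 (c ^ (0 : ℝ))) :=
    (Real.continuousAt_const_rpow hc.ne').tendsto.comp hinv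
  rw [Real.rpow_zero] at hpow
  exact tendsto_comp_val_Ioi_atTop.2 hpow

theorem tendsto_rpow_one_div_sub_one_mul_zetaFun (hτ : IsNormalTrace N τ)
    (hA : A ∈ dixmierIdeal N τ) (hA0 : 0 ≤ A) (hc : 0 < c) :
    Tendsto (fun t : Ioi (0 : ℝ) => (c ^ (1 / (t : ℝ)) - 1) * zetaFun τ A t) atTop (𝓝 0) := by
  obtain ⟨C, -, hC⟩ := exists_zetaFun_le hτ hA hA0
  refine Tendsto.zero_mul_isBoundedUnder_le
    (by simpa only [sub_self] using (tendsto_rpow_one_div hc).sub_const 1)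
    (isBoundedUnder_of_eventually_le (a := C) ?_)
  filter_upwards [eventually_gt_coe_atTop 1] with t ht
  rw [Function.comp_apply, Real.norm_of_nonneg (zetaFun_nonneg τ A t)]
  exact hC t ht.le

theorem zetaFun_add_zetaFun_le (hτ : IsNormalTrace N τ) (hA : A ∈ dixmierIdeal N τ) (hA0 : 0 ≤ A)
    (hB : B ∈ dixmierIdeal N τ) (hB0 : 0 ≤ B) {t : Ioi (0 : ℝ)} (ht : 1 < (t : ℝ)) :
    zetaFun τ A t + zetaFun τ B t ≤ zetaFun τ (A + B) t := by
  have hinv : 0 < 1 / (t : ℝ) := one_div_pos.2 t.2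
  have hp := one_lt_one_add_one_div t
  simp only [zetaFun]
  rw [← mul_add, ← ENNReal.toReal_add (tau_rpow_lt_top hτ hA hA0 hp).ne
    (tau_rpow_lt_top hτ hB hB0 hp).ne]
  exact mul_le_mul_of_nonneg_left (ENNReal.toReal_mono
    (tau_rpow_lt_top hτ (add_mem_dixmierIdeal hτ hA hB) (add_nonneg hA0 hB0) hp).ne
    (tau_rpow_add_tau_rpow_le hτ hA.1 hA0 hB.1 hB0 hinv ((div_le_one t.2).2 ht.le))) hinv.le

theorem zetaFun_add_le (hτ : IsNormalTrace N τ) (hA : A ∈ dixmierIdeal N τ) (hA0 : 0 ≤ A)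
    (hB : B ∈ dixmierIdeal N τ) (hB0 : 0 ≤ B) {t : Ioi (0 : ℝ)} (ht : 1 < (t : ℝ)) :
    zetaFun τ (A + B) t ≤ 2 ^ (1 / (t : ℝ)) * (zetaFun τ A t + zetaFun τ B t) := by
  have hinv : 0 < 1 / (t : ℝ) := one_div_pos.2 t.2
  have hA_fin := (tau_rpow_lt_top hτ hA hA0 (one_lt_one_add_one_div t)).ne
  have hB_fin := (tau_rpow_lt_top hτ hB hB0 (one_lt_one_add_one_div t)).ne
  have hle := ENNReal.toReal_mono
    (ENNReal.mul_ne_top ENNReal.ofReal_ne_top (ENNReal.add_ne_top.2 ⟨hA_fin, hB_fin⟩))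
    (tau_add_rpow_le hτ hA.1 hA0 hB.1 hB0 hinv ((div_lt_one t.2).2 ht))
  rw [ENNReal.toReal_mul, ENNReal.toReal_ofReal (by positivity),
    ENNReal.toReal_add hA_fin hB_fin] at hle
  simp only [zetaFun]
  rw [← mul_add, mul_left_comm]
  exact mul_le_mul_of_nonneg_left hle hinv.le

theorem zetaFun_smul (hτ : IsNormalTrace N τ) (hA : A ∈ N) (hA0 : 0 ≤ A) (hc : 0 ≤ c)
    (t : Ioi (0 : ℝ)) : zetaFun τ (c • A) t = c ^ (1 + 1 / (t : ℝ)) * zetaFun τ A t := by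
  rw [zetaFun, smul_rpow hA0 hc (zero_le_one.trans (one_lt_one_add_one_div t).le),
    hτ.map_smul _ (by positivity) _ (rpow_mem hA _) CFC.rpow_nonneg, ENNReal.toReal_mul,
    ENNReal.toReal_ofReal (by positivity), mul_left_comm, zetaFun]

theorem zetaPos_add (hτ : IsNormalTrace N τ) (hγ : IsGeneralisedLimit γ)
    (hA : A ∈ dixmierIdeal N τ) (hA0 : 0 ≤ A) (hB : B ∈ dixmierIdeal N τ) (hB0 : 0 ≤ B) :
    zetaPos τ γ (A + B) = zetaPos τ γ A + zetaPos τ γ B := by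
  obtain ⟨z, hzA, hz⟩ := exists_zetaPos_eq hτ γ hA hA0
  obtain ⟨w, hwB, hw⟩ := exists_zetaPos_eq hτ γ hB hB0
  have hlim : Tendsto (fun t : Ioi (0 : ℝ) =>
      ((2 : ℝ) ^ (1 / (t : ℝ)) - 1) * (zetaFun τ A t + zetaFun τ B t)) atTop (𝓝 0) := by
    simpa only [mul_add, add_zero] using
      (tendsto_rpow_one_div_sub_one_mul_zetaFun hτ hA hA0 two_pos).add
        (tendsto_rpow_one_div_sub_one_mul_zetaFun hτ hB hB0 two_pos)
  have hsum : ∀ᶠ t in atTop, (z + w).1 t = zetaFun τ A t + zetaFun τ B t := by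
    filter_upwards [hzA, hwB] with t hzt hwt
    exact congrArg₂ (· + ·) hzt hwt
  rw [hz, hw, ← map_add]
  refine zetaPos_eq_of_tendsto hτ hγ (add_mem_dixmierIdeal hτ hA hB) (add_nonneg hA0 hB0)
    (squeeze_zero' ?_ ?_ hlim)
  all_goals filter_upwards [hsum, eventually_gt_coe_atTop 1] with t hsum_t ht
  · linarith [zetaFun_add_zetaFun_le hτ hA hA0 hB hB0 ht]
  · linarith [zetaFun_add_le hτ hA hA0 hB hB0 ht]

theorem zetaPos_zero (hτ : IsNormalTrace N τ) (hγ : IsGeneralisedLimit γ) :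
    zetaPos τ γ (0 : H →L[ℂ] H) = 0 := by
  have hadd := zetaPos_add hτ hγ (zero_mem_dixmierIdeal hτ) le_rfl (zero_mem_dixmierIdeal hτ) le_rfl
  rw [add_zero] at hadd
  linarith

theorem zetaPos_smul (hτ : IsNormalTrace N τ) (hγ : IsGeneralisedLimit γ)
    (hA : A ∈ dixmierIdeal N τ) (hA0 : 0 ≤ A) (hc : 0 ≤ c) :
    zetaPos τ γ (c • A) = c * zetaPos τ γ A := by
  obtain rfl | hc := hc.eq_or_lt
  · rw [zero_smul, zero_mul, zetaPos_zero hτ hγ]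
  obtain ⟨z, hzA, hz⟩ := exists_zetaPos_eq hτ γ hA hA0
  have hlim := (tendsto_rpow_one_div_sub_one_mul_zetaFun hτ hA hA0 hc).const_mul c
  rw [mul_zero] at hlim
  rw [hz, ← smul_eq_mul, ← map_smul]
  refine zetaPos_eq_of_tendsto hτ hγ (real_smul_mem_dixmierIdeal hτ c hA) (smul_nonneg hc.le hA0)
    (hlim.congr' ?_)
  filter_upwards [hzA] with t ht
  rw [zetaFun_smul hτ hA.1 hA0 hc.le, Real.rpow_add hc, Real.rpow_one, Submodule.coe_smul,
    Pi.smul_apply, ht, smul_eq_mul]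
  ring

theorem zetaPos_le_of_majorized (hτ : IsNormalTrace N τ) (hγ : IsGeneralisedLimit γ)
    (hA : A ∈ dixmierIdeal N τ) (hA0 : 0 ≤ A) (hB : B ∈ dixmierIdeal N τ) (hB0 : 0 ≤ B)
    (h : Majorized N τ B A) : zetaPos τ γ B ≤ zetaPos τ γ A := by
  rw [zetaPos, zetaPos, dif_pos (indicator_zetaFun_mem hτ hA hA0),
    dif_pos (indicator_zetaFun_mem hτ hB hB0), ← sub_nonneg, ← map_sub]
  refine hγ.nonneg _ fun t => sub_nonneg.2 (indicator_le_indicator ?_)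
  have hp := one_lt_one_add_one_div t
  exact mul_le_mul_of_nonneg_left (ENNReal.toReal_mono (tau_rpow_lt_top hτ hA hA0 hp).ne
    (tau_rpow_le_of_majorized hτ hA.1 hA0 hB.1 hB0 h hp)) (one_div_pos.2 t.2).le

end ZetaOfPositive

section JordanExtension

variable {𝓐 : Type*} [CStarAlgebra 𝓐] {S : Submodule ℂ 𝓐} {f : 𝓐 → ℝ} {a b : 𝓐}

/-- A subspace of a C⋆-algebra closed under adjoints and under positive parts of self-adjoint
elements, so that it contains, with each of its elements `a`, the four positive elements
`(ℜ a)⁺`, `(ℜ a)⁻`, `(ℑ a)⁺`, `(ℑ a)⁻`. -/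
structure IsJordanClosed (S : Submodule ℂ 𝓐) : Prop where
  star_mem : ∀ a ∈ S, star a ∈ S
  posPart_mem : ∀ a ∈ S, IsSelfAdjoint a → a⁺ ∈ S

theorem IsJordanClosed.realPart_mem (hS : IsJordanClosed S) (ha : a ∈ S) : (ℜ a : 𝓐) ∈ S := by
  rw [realPart_apply_coe]
  exact S.smul_of_tower_mem _ (S.add_mem ha (hS.star_mem a ha))

theorem IsJordanClosed.imaginaryPart_mem (hS : IsJordanClosed S) (ha : a ∈ S) :
    (ℑ a : 𝓐) ∈ S := by
  rw [imaginaryPart_apply_coe]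
  exact S.smul_mem _ (S.smul_of_tower_mem _ (S.sub_mem ha (hS.star_mem a ha)))

theorem IsJordanClosed.negPart_mem (hS : IsJordanClosed S) (ha : a ∈ S) (has : IsSelfAdjoint a) :
    a⁻ ∈ S := by
  rw [← CFC.posPart_neg]
  exact hS.posPart_mem _ (S.neg_mem ha) has.neg

/-- The extension of a function on the positive elements of a C⋆-algebra to self-adjoint elements
through the Jordan decomposition `a = a⁺ - a⁻`. -/
noncomputable def jordanDiff (f : 𝓐 → ℝ) (a : 𝓐) : ℝ :=
  f a⁺ - f a⁻

/-- The extension of a function on the positive elements of a C⋆-algebra to all elements through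
`a = (ℜ a)⁺ - (ℜ a)⁻ + i ((ℑ a)⁺ - (ℑ a)⁻)`. -/
noncomputable def jordanExtension (f : 𝓐 → ℝ) (a : 𝓐) : ℂ :=
  (jordanDiff f (ℜ a) : ℂ) + Complex.I * (jordanDiff f (ℑ a) : ℂ)

variable [PartialOrder 𝓐]

/-- `f` is additive and positively homogeneous on the positive elements of `S`; its other values
play no role. -/
structure IsConeLinear (S : Submodule ℂ 𝓐) (f : 𝓐 → ℝ) : Prop where
  map_add : ∀ a ∈ S, ∀ b ∈ S, 0 ≤ a → 0 ≤ b → f (a + b) = f a + f b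
  map_smul : ∀ c : ℝ, 0 ≤ c → ∀ a ∈ S, 0 ≤ a → f (c • a) = c * f a

theorem IsConeLinear.map_zero (hf : IsConeLinear S f) : f 0 = 0 := by
  simpa only [zero_smul, zero_mul] using hf.map_smul 0 le_rfl 0 S.zero_mem le_rfl

variable [StarOrderedRing 𝓐]

theorem jordanDiff_sub (hS : IsJordanClosed S) (hf : IsConeLinear S f) (ha : a ∈ S) (ha0 : 0 ≤ a)
    (hb : b ∈ S) (hb0 : 0 ≤ b) : jordanDiff f (a - b) = f a - f b := by
  have hab : a - b ∈ S := S.sub_mem ha hb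
  have hab_sa : IsSelfAdjoint (a - b) := (IsSelfAdjoint.of_nonneg ha0).sub (.of_nonneg hb0)
  have hparts : (a - b)⁺ + b = a + (a - b)⁻ :=
    sub_eq_sub_iff_add_eq_add.1 (CFC.posPart_sub_negPart (a - b) hab_sa)
  have hvalues := congrArg f hparts
  rw [hf.map_add _ (hS.posPart_mem _ hab hab_sa) _ hb (CFC.posPart_nonneg _) hb0,
    hf.map_add _ ha _ (hS.negPart_mem hab hab_sa) ha0 (CFC.negPart_nonneg _)] at hvalues
  rw [jordanDiff]
  linarith

theorem jordanDiff_add (hS : IsJordanClosed S) (hf : IsConeLinear S f) (ha : a ∈ S)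
    (ha_sa : IsSelfAdjoint a) (hb : b ∈ S) (hb_sa : IsSelfAdjoint b) :
    jordanDiff f (a + b) = jordanDiff f a + jordanDiff f b := by
  have hparts : a + b = (a⁺ + b⁺) - (a⁻ + b⁻) := by
    rw [add_sub_add_comm, CFC.posPart_sub_negPart a ha_sa, CFC.posPart_sub_negPart b hb_sa]
  have hap := hS.posPart_mem a ha ha_sa
  have hbp := hS.posPart_mem b hb hb_sa
  have han := hS.negPart_mem ha ha_sa
  have hbn := hS.negPart_mem hb hb_sa
  rw [hparts, jordanDiff_sub hS hf
      (S.add_mem hap hbp) (add_nonneg (CFC.posPart_nonneg a) (CFC.posPart_nonneg b))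
      (S.add_mem han hbn) (add_nonneg (CFC.negPart_nonneg a) (CFC.negPart_nonneg b)),
    hf.map_add _ hap _ hbp (CFC.posPart_nonneg a) (CFC.posPart_nonneg b),
    hf.map_add _ han _ hbn (CFC.negPart_nonneg a) (CFC.negPart_nonneg b), jordanDiff, jordanDiff]
  ring

theorem jordanDiff_smul (hS : IsJordanClosed S) (hf : IsConeLinear S f) (ha : a ∈ S)
    (ha_sa : IsSelfAdjoint a) (c : ℝ) : jordanDiff f (c • a) = c * jordanDiff f a := by
  have hpos := hS.posPart_mem a ha ha_sa
  have hneg := hS.negPart_mem ha ha_sa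
  obtain hc | hc := le_total 0 c
  · rw [jordanDiff, CFC.posPart_smul_of_nonneg hc, CFC.negPart_smul_of_nonneg hc,
      hf.map_smul c hc _ hpos (CFC.posPart_nonneg a),
      hf.map_smul c hc _ hneg (CFC.negPart_nonneg a), jordanDiff]
    ring
  · have hc' : 0 ≤ -c := neg_nonneg.2 hc
    rw [jordanDiff, CFC.posPart_smul_of_nonpos hc, CFC.negPart_smul_of_nonpos hc,
      hf.map_smul _ hc' _ hneg (CFC.negPart_nonneg a),
      hf.map_smul _ hc' _ hpos (CFC.posPart_nonneg a), jordanDiff]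
    ring

theorem jordanExtension_of_nonneg (hf : IsConeLinear S f) (ha0 : 0 ≤ a) :
    jordanExtension f a = (f a : ℂ) := by
  have ha_sa : IsSelfAdjoint a := .of_nonneg ha0
  have hzero : jordanDiff f (0 : 𝓐) = 0 := by
    rw [jordanDiff, CFC.posPart_zero, CFC.negPart_zero, sub_self]
  rw [jordanExtension, ha_sa.coe_realPart, ha_sa.imaginaryPart, ZeroMemClass.coe_zero, hzero,
    jordanDiff, (CFC.posPart_eq_self a).2 ha0, (CFC.negPart_eq_zero_iff a ha_sa).2 ha0,
    hf.map_zero, sub_zero, Complex.ofReal_zero, mul_zero, add_zero]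

theorem jordanExtension_add (hS : IsJordanClosed S) (hf : IsConeLinear S f) (ha : a ∈ S)
    (hb : b ∈ S) : jordanExtension f (a + b) = jordanExtension f a + jordanExtension f b := by
  simp only [jordanExtension, map_add, AddSubgroup.coe_add]
  rw [jordanDiff_add hS hf (hS.realPart_mem ha) (ℜ a).2 (hS.realPart_mem hb) (ℜ b).2,
    jordanDiff_add hS hf (hS.imaginaryPart_mem ha) (ℑ a).2 (hS.imaginaryPart_mem hb) (ℑ b).2,
    Complex.ofReal_add, Complex.ofReal_add]
  ring

theorem jordanExtension_smul (hS : IsJordanClosed S) (hf : IsConeLinear S f) (c : ℂ) (ha : a ∈ S) :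
    jordanExtension f (c • a) = c * jordanExtension f a := by
  have hcomb : ∀ r s : ℝ, jordanDiff f (r • (ℜ a : 𝓐) + s • (ℑ a : 𝓐)) =
      r * jordanDiff f (ℜ a) + s * jordanDiff f (ℑ a) := fun r s => by
    have hre := hS.realPart_mem ha
    have him := hS.imaginaryPart_mem ha
    rw [jordanDiff_add hS hf (S.smul_of_tower_mem r hre) (r • ℜ a).2 (S.smul_of_tower_mem s him)
      (s • ℑ a).2, jordanDiff_smul hS hf hre (ℜ a).2, jordanDiff_smul hS hf him (ℑ a).2]
  have hre : (ℜ (c • a) : 𝓐) = c.re • (ℜ a : 𝓐) + (-c.im) • (ℑ a : 𝓐) := by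
    rw [realPart_smul, AddSubgroup.coe_sub, selfAdjoint.val_smul, selfAdjoint.val_smul, neg_smul,
      sub_eq_add_neg]
  have him : (ℑ (c • a) : 𝓐) = c.im • (ℜ a : 𝓐) + c.re • (ℑ a : 𝓐) := by
    rw [imaginaryPart_smul, AddSubgroup.coe_add, selfAdjoint.val_smul, selfAdjoint.val_smul]
    abel
  rw [jordanExtension, hre, him, hcomb, hcomb, jordanExtension]
  exact Complex.ext (by simp [sub_eq_add_neg]) (by simp [add_comm])

/-- The complex-linear functional on `S` extending a cone-linear function. -/
noncomputable def jordanLinearMap (hS : IsJordanClosed S) (hf : IsConeLinear S f) : S →ₗ[ℂ] ℂ where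
  toFun a := jordanExtension f (a : 𝓐)
  map_add' a b := jordanExtension_add hS hf a.2 b.2
  map_smul' c a := jordanExtension_smul hS hf c a.2

end JordanExtension

section ZetaLinear

variable {H : Type*} [NormedAddCommGroup H] [InnerProductSpace ℂ H] [CompleteSpace H]
  {N : VonNeumannAlgebra H} {τ : (H →L[ℂ] H) → ℝ≥0∞} {A : H →L[ℂ] H} {γ : LInfty →ₗ[ℝ] ℝ}

theorem zeta_eq_jordanExtension (τ : (H →L[ℂ] H) → ℝ≥0∞) (γ : LInfty →ₗ[ℝ] ℝ) (A : H →L[ℂ] H) :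
    zeta τ γ A = jordanExtension (zetaPos τ γ) A := by
  simp only [zeta, jordanExtension, jordanDiff, Complex.ofReal_sub]

theorem isJordanClosed_dixmierSubmodule (hτ : IsNormalTrace N τ) :
    IsJordanClosed (dixmierSubmodule hτ) :=
  ⟨fun _ => star_mem_dixmierIdeal hτ, fun _ => posPart_mem_dixmierIdeal hτ⟩

theorem isConeLinear_zetaPos (hτ : IsNormalTrace N τ) (hγ : IsGeneralisedLimit γ) :
    IsConeLinear (dixmierSubmodule hτ) (zetaPos τ γ) :=
  ⟨fun _ hA _ hB hA0 hB0 => zetaPos_add hτ hγ hA hA0 hB hB0,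
    fun _ hc _ hA hA0 => zetaPos_smul hτ hγ hA hA0 hc⟩

theorem zeta_of_nonneg (hτ : IsNormalTrace N τ) (hγ : IsGeneralisedLimit γ) (hA0 : 0 ≤ A) :
    zeta τ γ A = (zetaPos τ γ A : ℂ) := by
  rw [zeta_eq_jordanExtension, jordanExtension_of_nonneg (isConeLinear_zetaPos hτ hγ) hA0]

/-- The zeta functional as a linear functional on the Dixmier ideal. -/
noncomputable def zetaLinear (hτ : IsNormalTrace N τ) (hγ : IsGeneralisedLimit γ) :
    dixmierSubmodule hτ →ₗ[ℂ] ℂ :=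
  jordanLinearMap (isJordanClosed_dixmierSubmodule hτ) (isConeLinear_zetaPos hτ hγ)

theorem zetaLinear_apply (hτ : IsNormalTrace N τ) (hγ : IsGeneralisedLimit γ)
    (A : dixmierSubmodule hτ) : zetaLinear hτ hγ A = zeta τ γ (A : H →L[ℂ] H) :=
  (zeta_eq_jordanExtension τ γ A).symm

theorem isFullySymmetric_zetaLinear (hτ : IsNormalTrace N τ) (hγ : IsGeneralisedLimit γ) :
    IsFullySymmetric N τ (zetaLinear hτ hγ) := by
  intro A B hA0 hB0 h
  rw [zetaLinear_apply, zetaLinear_apply, zeta_of_nonneg hτ hγ hA0, zeta_of_nonneg hτ hγ hB0]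
  exact Complex.real_le_real.2 (zetaPos_le_of_majorized hτ hγ A.2 hA0 B.2 hB0 h)

end ZetaLinear

end ZetaFunctional

open ZetaFunctional in
theorem mainTheorem5_general {H : Type*} [NormedAddCommGroup H] [InnerProductSpace ℂ H]
    [CompleteSpace H] (N : VonNeumannAlgebra H) (τ : (H →L[ℂ] H) → ℝ≥0∞)
    (hτ : IsNormalTrace N τ) (γ : LInfty →ₗ[ℝ] ℝ) (hγ : IsGeneralisedLimit γ) :
    (∀ A ∈ dixmierIdeal N τ,
      (ℜ A : H →L[ℂ] H)⁺ ∈ dixmierIdeal N τ ∧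
      (ℜ A : H →L[ℂ] H)⁻ ∈ dixmierIdeal N τ ∧
      (ℑ A : H →L[ℂ] H)⁺ ∈ dixmierIdeal N τ ∧
      (ℑ A : H →L[ℂ] H)⁻ ∈ dixmierIdeal N τ) ∧
    (∀ A ∈ dixmierIdeal N τ, 0 ≤ A →
      (∀ t : ℝ, 0 < t → τ (A ^ (1 + 1 / t)) < ∞) ∧
      (∃ z : LInfty, z.1 =ᶠ[atTop] zetaFun τ A) ∧
      ∀ z : LInfty, z.1 =ᶠ[atTop] zetaFun τ A →
        zeta τ γ A = (γ z : ℂ)) ∧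
    ∃ (S : Submodule ℂ (H →L[ℂ] H)) (φ : S →ₗ[ℂ] ℂ),
      (S : Set (H →L[ℂ] H)) = dixmierIdeal N τ ∧
      (∀ A : S, φ A = zeta τ γ (A : H →L[ℂ] H)) ∧
      IsFullySymmetric N τ φ := by
  have hJ := isJordanClosed_dixmierSubmodule hτ
  refine ⟨fun A hA => ?_, fun A hA hA0 => ⟨fun t ht => ?_, ?_, fun z hz => ?_⟩,
    dixmierSubmodule hτ, zetaLinear hτ hγ, rfl, zetaLinear_apply hτ hγ,
    isFullySymmetric_zetaLinear hτ hγ⟩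
  · have hre := hJ.realPart_mem hA
    have him := hJ.imaginaryPart_mem hA
    exact ⟨hJ.posPart_mem _ hre (ℜ A).2, hJ.negPart_mem hre (ℜ A).2,
      hJ.posPart_mem _ him (ℑ A).2, hJ.negPart_mem him (ℑ A).2⟩
  · exact tau_rpow_lt_top hτ hA hA0 (one_lt_one_add_one_div ⟨t, ht⟩)
  · exact ⟨⟨_, indicator_zetaFun_mem hτ hA hA0⟩, indicator_zetaFun_eventuallyEq τ A⟩
  · rw [zeta_of_nonneg hτ hγ hA0, zetaPos_eq_of_eventuallyEq hτ hγ hA hA0 hz]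

theorem mainTheorem5 {H : Type*} [NormedAddCommGroup H] [InnerProductSpace ℂ H] [CompleteSpace H]
    (N : VonNeumannAlgebra H) (τ : (H →L[ℂ] H) → ℝ≥0∞)
    (hτ : ZetaFunctional.IsFaithfulNormalSemifiniteTrace N τ)
    (γ : ZetaFunctional.LInfty →ₗ[ℝ] ℝ) (hγ : ZetaFunctional.IsGeneralisedLimit γ) :
    -- the four positive parts of an operator in the ideal lie in the ideal
    (∀ A ∈ ZetaFunctional.dixmierIdeal N τ,
      (ℜ A : H →L[ℂ] H)⁺ ∈ ZetaFunctional.dixmierIdeal N τ ∧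
      (ℜ A : H →L[ℂ] H)⁻ ∈ ZetaFunctional.dixmierIdeal N τ ∧
      (ℑ A : H →L[ℂ] H)⁺ ∈ ZetaFunctional.dixmierIdeal N τ ∧
      (ℑ A : H →L[ℂ] H)⁻ ∈ ZetaFunctional.dixmierIdeal N τ) ∧
    -- on positive operators the functional is well defined and given by the formula
    (∀ A ∈ ZetaFunctional.dixmierIdeal N τ, 0 ≤ A →
      (∀ t : ℝ, 0 < t → τ (A ^ (1 + 1 / t)) < ∞) ∧
      (∃ z : ZetaFunctional.LInfty, z.1 =ᶠ[atTop] ZetaFunctional.zetaFun τ A) ∧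
      ∀ z : ZetaFunctional.LInfty, z.1 =ᶠ[atTop] ZetaFunctional.zetaFun τ A →
        ZetaFunctional.zeta τ γ A = (γ z : ℂ)) ∧
    -- the functional is linear and fully symmetric on the ideal
    ∃ (S : Submodule ℂ (H →L[ℂ] H)) (φ : S →ₗ[ℂ] ℂ),
      (S : Set (H →L[ℂ] H)) = ZetaFunctional.dixmierIdeal N τ ∧
      (∀ A : S, φ A = ZetaFunctional.zeta τ γ (A : H →L[ℂ] H)) ∧
      ZetaFunctional.IsFullySymmetric N τ φ :=
  mainTheorem5_general N τ hτ.isNormalTrace γ hγ
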